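/- **Setting.** Let $\Gamma^l,\Gamma^r\subset\mathbb R^2$ be fixed simple curves, each connecting $(0,1)$ and $(0,-1)$, let $R_0\ge 1$, and for every $R\ge R_0$ let $\Omega_R\subset\mathbb R^2$ be a bounded domain with Lipschitz boundary $$\partial\Omega_R=\Gamma_R^+\cup\Gamma_R^-\cup\Gamma_R^l\cup\Gamma_R^r,\qquad \Gamma_R^\pm=[-R,R]\times\{\pm1\},\quad \Gamma_R^l=\Gamma^l+(-R,0),\quad \Gamma_R^r=\Gamma^r+(R,0),$$ where $\Gamma_R^l\cup\Gamma_R^r$ meets $\Gamma_R^+\cup\Gamma_R^-$ only at the points $(\pm R,\pm1)$. (Example: $\Omega_R=(-R,R)\times(-1,1)$.) Let $ds$ be arc length and $\nu_y$ the outward unit normal on $\partial\Omega_R$ (defined almost everywhere). The Neumann–Poincaré operator is $$\mathcal K_R[\varphi](x)=\mathrm{p.v.}\,\frac1{2\pi}\int_{\partial\Omega_R}\frac{\langle y-x,\nu_y\rangle}{|x-y|^2}\,\varphi(y)\,ds(y),\qquad x\in\partial\Omega_R,$$ where the principal value is the limit as $\varepsilon\to0^+$ of the integrals over $\{y\in\partial\Omega_R:|x-y|\ge\varepsilon\}$,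 and $H^{1/2}(\partial\Omega_R)$ is the space of measurable $h:\partial\Omega_R\to\mathbb C$ with finite norm $$\|h\|_{H^{1/2}(\partial\Omega_R)}=\Big(\int_{\partial\Omega_R}|h|^2\,ds+\int_{\partial\Omega_R}\int_{\partial\Omega_R}\frac{|h(x)-h(z)|^2}{|x-z|^2}\,ds(x)\,ds(z)\Big)^{1/2}.$$ **Proposition 3.1.** Let $\lambda\in(0,1/2]$. There are functions $\varphi_R\in H^{1/2}(\partial\Omega_R)$, $R\ge R_0$, with $\|\varphi_R\|_{H^{1/2}(\partial\Omega_R)}\neq0$, such that for every $R\ge R_0$ the principal value $\mathcal K_R[\varphi_R](x)$ exists for almost every $x\in\partial\Omega_R$ and $(\lambda I-\mathcal K_R)[\varphi_R]\in H^{1/2}(\partial\Omega_R)$, and $$\lim_{R\to\infty}\frac{\|(\lambda I-\mathcal K_R)[\varphi_R]\|_{H^{1/2}(\partial\Omega_R)}}{\|\varphi_R\|_{H^{1/2}(\partial\Omega_R)}}=0.$$ -/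

import Mathlib

open MeasureTheory Filter Topology
open scoped ENNReal NNReal

namespace ThinNP

/-- The Euclidean plane. -/
abbrev Plane : Type := EuclideanSpace ℝ (Fin 2)

/-! ### Lipschitz domains, arc length, outward normal -/

/-- A bounded planar Lipschitz domain: a bounded, connected (nonempty) open set which near each of
its boundary points `p` is, in a Cartesian coordinate system centred at `p`, the region below the
graph of a Lipschitz function. -/
structure IsBoundedLipschitzDomain (Ω : Set Plane) : Prop where
  isOpen : IsOpen Ω
  isConnected : IsConnected Ω
  isBounded : Bornology.IsBounded Ω
  local_graph : ∀ p ∈ frontier Ω, ∃ (T : Plane ≃ₗᵢ[ℝ] Plane) (g : ℝ → ℝ) (L : ℝ≥0) (r : ℝ),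
    LipschitzWith L g ∧ 0 < r ∧
      ∀ x ∈ Metric.ball p r, x ∈ Ω ↔ (T (x - p)) 1 < g ((T (x - p)) 0)

/-- The line element on `∂Ω`: one-dimensional Hausdorff measure (arc length) restricted
to `∂Ω`. -/
noncomputable def arcLength (Ω : Set Plane) : Measure Plane :=
  (Measure.hausdorffMeasure 1).restrict (frontier Ω)

/-- `ν` is the outward unit normal of `Ω` at `y`: however thin a double cone around the line
orthogonal to `ν` is removed, close to `y` the part on the side of `ν` lies outside `Ω` and the part
on the other side lies in `Ω`. At a boundary point where the graph function of a Lipschitz domain is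
differentiable this is the usual outward normal. -/
def IsOutwardUnitNormal (Ω : Set Plane) (y ν : Plane) : Prop :=
  ‖ν‖ = 1 ∧ ∀ ε : ℝ, 0 < ε → ∀ᶠ z in 𝓝 y,
    (ε * ‖z - y‖ < inner ℝ (z - y) ν → z ∉ Ω) ∧
    (inner ℝ (z - y) ν < -(ε * ‖z - y‖) → z ∈ Ω)

open Classical in
/-- The outward unit normal `ν_y` (unique where it exists; for a Lipschitz domain it exists at
almost every boundary point), and `0` at points without a normal. -/
noncomputable def outwardNormal (Ω : Set Plane) (y : Plane) : Plane :=
  if h : ∃ ν, IsOutwardUnitNormal Ω y ν then h.choose else 0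

/-! ### The Neumann–Poincaré operator -/

/-- The integral kernel `k(x,y) = (1/2π) ⟨y - x, ν_y⟩ / |x - y|²`. -/
noncomputable def npKernel (Ω : Set Plane) (x y : Plane) : ℝ :=
  1 / (2 * Real.pi) * (inner ℝ (y - x) (outwardNormal Ω y) / ‖x - y‖ ^ 2)

/-- The truncated integral `∫_{y ∈ ∂Ω, |x - y| ≥ ε} k(x,y) φ(y) ds(y)`. -/
noncomputable def npTrunc (Ω : Set Plane) (φ : Plane → ℂ) (x : Plane) (ε : ℝ) : ℂ :=
  ∫ y in {y | ε ≤ dist x y}, (npKernel Ω x y : ℂ) * φ y ∂(arcLength Ω)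

/-- The principal value integral defining `K_{∂Ω}[φ](x)` exists: the truncated integrals converge
absolutely, and they have a limit as `ε → 0+`. -/
def NPExists (Ω : Set Plane) (φ : Plane → ℂ) (x : Plane) : Prop :=
  (∀ ε : ℝ, 0 < ε →
    IntegrableOn (fun y => (npKernel Ω x y : ℂ) * φ y) {y | ε ≤ dist x y} (arcLength Ω)) ∧
  ∃ l : ℂ, Tendsto (npTrunc Ω φ x) (𝓝[>] 0) (𝓝 l)

/-- The Neumann–Poincaré operator `K_{∂Ω}[φ](x) = p.v. ∫_{∂Ω} k(x,y) φ(y) ds(y)`. -/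
noncomputable def npOperator (Ω : Set Plane) (φ : Plane → ℂ) (x : Plane) : ℂ :=
  limUnder (𝓝[>] 0) (npTrunc Ω φ x)

/-! ### The space `H^{1/2}(∂Ω)` -/

/-- `‖h‖_{H^{1/2}(∂Ω)} = (∫ |h(x)|² ds(x) + ∫∫ |h(x) - h(z)|² / |x - z|² ds(x) ds(z))^{1/2}`,
with value `∞` when an integral diverges. Only the values of `h` on `∂Ω` matter. -/
noncomputable def hHalfNorm (Ω : Set Plane) (h : Plane → ℂ) : ℝ≥0∞ :=
  ((∫⁻ x, ‖h x‖ₑ ^ 2 ∂(arcLength Ω)) +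
    ∫⁻ x, ∫⁻ z, ‖h x - h z‖ₑ ^ 2 / edist x z ^ 2 ∂(arcLength Ω) ∂(arcLength Ω)) ^ (1 / 2 : ℝ)

/-- `h ∈ H^{1/2}(∂Ω)`. -/
def MemHHalf (Ω : Set Plane) (h : Plane → ℂ) : Prop :=
  AEStronglyMeasurable h (arcLength Ω) ∧ hHalfNorm Ω h < ∞

/-! ### Thin domains -/

/-- `Γ` is a simple curve connecting `a` and `b`. -/
def IsSimpleCurve (Γ : Set Plane) (a b : Plane) : Prop :=
  ∃ γ : Path a b, Function.Injective γ ∧ Set.range γ = Γ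

/-- The long sides `Γ_R^+ ∪ Γ_R^- = [-R,R] × {1} ∪ [-R,R] × {-1}`. -/
def longSides (R : ℝ) : Set Plane :=
  {x | |x 0| ≤ R ∧ x 1 = 1} ∪ {x | |x 0| ≤ R ∧ x 1 = -1}

/-- The short sides `Γ_R^s`: the fixed curve `Γl` translated by `(-R, 0)` and the fixed curve `Γr`
translated by `(R, 0)`. -/
noncomputable def shortSides (Γl Γr : Set Plane) (R : ℝ) : Set Plane :=
  (fun x => x + !₂[-R, 0]) '' Γl ∪ (fun x => x + !₂[R, 0]) '' Γr

/-- `Ω` is the thin domain `Ω_R` with short sides of shape `Γl` and `Γr`: a bounded Lipschitz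
domain whose boundary consists of the long sides and the short sides, which meet only at the corner
points `(±R, ±1)`. -/
structure IsThinDomain (Γl Γr : Set Plane) (R : ℝ) (Ω : Set Plane) : Prop where
  lipschitz : IsBoundedLipschitzDomain Ω
  frontier_eq : frontier Ω = longSides R ∪ shortSides Γl Γr R
  inter_subset : longSides R ∩ shortSides Γl Γr R ⊆
    {!₂[R, 1], !₂[R, -1], !₂[-R, 1], !₂[-R, -1]}

end ThinNP

/-!
On the boundary of a long thin domain, the double-layer kernel vanishes between two points of the
same long side, while between the two long sides, at distance `2`, it is convolution with
`1 / (π (4 + s²))`. The Fourier symbol of this convolution takes every value in `(0, 1/2]`. Let `ξ`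
be a frequency at which it equals `λ`, and let `φ` have the same profile on both long sides: the
wave of frequency `ξ` cut off by a tent of width `w ∼ R / 2`. Then `λφ - Kφ` measures only how much
the tent varies, and for every `θ < 1` it is `O(w^(-θ))`, both pointwise and in Lipschitz constant
(the kernel has moments of every order below `1`); the short sides are at distance `∼ w` from the
support of `φ`. As the boundary has length `O(w)`, the `H^{1/2}` norm of `λφ - Kφ` is
`O(w^(1-θ))`, and that of `φ` is at least of order `w^(1/2)`. Any `θ` in `(1/2, 1)` will do.
-/

namespace ThinNP

/-! ### Bounded Lipschitz functions -/

section BoundedLipschitz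

variable {X E : Type*} [PseudoMetricSpace X] [SeminormedAddCommGroup E] {A B : Set X} {L L' : ℝ}

/-- On `A`, the function `h` is bounded by `L` and has Lipschitz constant `L`. One constant serves
both purposes because the bounds for the `H^{1/2}` norm need both. -/
structure BoundedLipschitzOnWith (L : ℝ) (h : X → E) (A : Set X) : Prop where
  norm_le : ∀ x ∈ A, ‖h x‖ ≤ L
  norm_sub_le : ∀ x ∈ A, ∀ z ∈ A, ‖h x - h z‖ ≤ L * dist x z

namespace BoundedLipschitzOnWith

variable {h k : X → E}

theorem mono (H : BoundedLipschitzOnWith L h A) (hL : L ≤ L') (hBA : B ⊆ A) :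
    BoundedLipschitzOnWith L' h B where
  norm_le x hx := (H.norm_le x (hBA hx)).trans hL
  norm_sub_le x hx z hz := (H.norm_sub_le x (hBA hx) z (hBA hz)).trans (by gcongr)

theorem congr (H : BoundedLipschitzOnWith L h A) (hhk : Set.EqOn h k A) :
    BoundedLipschitzOnWith L k A where
  norm_le x hx := hhk hx ▸ H.norm_le x hx
  norm_sub_le x hx z hz := hhk hx ▸ hhk hz ▸ H.norm_sub_le x hx z hz

theorem comp_of_dist_le {Y : Type*} [PseudoMetricSpace Y] {S : Set Y} {f : Y → X}
    (H : BoundedLipschitzOnWith L h A) (hL : 0 ≤ L) (hf : ∀ y z, dist (f y) (f z) ≤ dist y z)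
    (hfA : Set.MapsTo f S A) : BoundedLipschitzOnWith L (h ∘ f) S where
  norm_le y hy := H.norm_le (f y) (hfA hy)
  norm_sub_le y hy z hz := (H.norm_sub_le _ (hfA hy) _ (hfA hz)).trans (by gcongr; exact hf y z)

theorem add (H : BoundedLipschitzOnWith L h A) (K : BoundedLipschitzOnWith L' k A) :
    BoundedLipschitzOnWith (L + L') (fun x => h x + k x) A where
  norm_le x hx := norm_add_le_of_le (H.norm_le x hx) (K.norm_le x hx)
  norm_sub_le x hx z hz := by
    rw [add_sub_add_comm, add_mul]
    exact norm_add_le_of_le (H.norm_sub_le x hx z hz) (K.norm_sub_le x hx z hz)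

theorem sub (H : BoundedLipschitzOnWith L h A) (K : BoundedLipschitzOnWith L' k A) :
    BoundedLipschitzOnWith (L + L') (fun x => h x - k x) A where
  norm_le x hx := norm_sub_le_of_le (H.norm_le x hx) (K.norm_le x hx)
  norm_sub_le x hx z hz := by
    rw [sub_sub_sub_comm, add_mul]
    exact norm_sub_le_of_le (H.norm_sub_le x hx z hz) (K.norm_sub_le x hx z hz)

theorem mul {R : Type*} [SeminormedRing R] {h k : X → R} (H : BoundedLipschitzOnWith L h A)
    (K : BoundedLipschitzOnWith L' k A) :
    BoundedLipschitzOnWith (2 * L * L') (fun x => h x * k x) A where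
  norm_le x hx := by
    have hL := (norm_nonneg _).trans (H.norm_le x hx)
    have hL' := (norm_nonneg _).trans (K.norm_le x hx)
    calc ‖h x * k x‖ ≤ L * L' := norm_mul_le_of_le (H.norm_le x hx) (K.norm_le x hx)
      _ ≤ 2 * L * L' := by nlinarith [mul_nonneg hL hL']
  norm_sub_le x hx z hz := by
    calc ‖h x * k x - h z * k z‖ = ‖h x * (k x - k z) + (h x - h z) * k z‖ := by
          congr 1; noncomm_ring
      _ ≤ L * (L' * dist x z) + L * dist x z * L' :=
          norm_add_le_of_le (norm_mul_le_of_le (H.norm_le x hx) (K.norm_sub_le x hx z hz))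
            (norm_mul_le_of_le (H.norm_sub_le x hx z hz) (K.norm_le z hz))
      _ = 2 * L * L' * dist x z := by ring

theorem const_mul {R : Type*} [SeminormedRing R] {h : X → R} (H : BoundedLipschitzOnWith L h A)
    (c : R) : BoundedLipschitzOnWith (‖c‖ * L) (fun x => c * h x) A where
  norm_le x hx := norm_mul_le_of_le le_rfl (H.norm_le x hx)
  norm_sub_le x hx z hz := by
    rw [← mul_sub, mul_assoc]
    exact norm_mul_le_of_le le_rfl (H.norm_sub_le x hx z hz)

theorem continuous (H : BoundedLipschitzOnWith L h Set.univ) : Continuous h := by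
  refine (LipschitzWith.of_dist_le_mul (K := L.toNNReal) fun x z => ?_).continuous
  rw [dist_eq_norm]
  exact (H.norm_sub_le x trivial z trivial).trans (by gcongr; exact Real.le_coe_toNNReal L)

/-- Points at distance at least `1` are harmless: there the bound alone gives the Lipschitz
estimate with constant `2 * L`. -/
theorem union (HA : BoundedLipschitzOnWith L h A) (HB : BoundedLipschitzOnWith L h B)
    (hAB : ∀ x ∈ A ∪ B, ∀ z ∈ A ∪ B, dist x z < 1 → x ∈ A ∧ z ∈ A ∨ x ∈ B ∧ z ∈ B) :
    BoundedLipschitzOnWith (2 * L) h (A ∪ B) := by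
  have hle : ∀ x ∈ A ∪ B, ‖h x‖ ≤ L := fun x hx => hx.elim (HA.norm_le x) (HB.norm_le x)
  have hL : ∀ x ∈ A ∪ B, 0 ≤ L := fun x hx => (norm_nonneg _).trans (hle x hx)
  refine ⟨fun x hx => by linarith [hle x hx, hL x hx], fun x hx z hz => ?_⟩
  rcases lt_or_ge (dist x z) 1 with hd | hd
  · have hnear : ‖h x - h z‖ ≤ L * dist x z := by
      rcases hAB x hx z hz hd with ⟨hx, hz⟩ | ⟨hx, hz⟩
      exacts [HA.norm_sub_le x hx z hz, HB.norm_sub_le x hx z hz]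
    nlinarith [mul_nonneg (hL x hx) (dist_nonneg (x := x) (y := z))]
  · calc ‖h x - h z‖ ≤ L + L := norm_sub_le_of_le (hle x hx) (hle z hz)
      _ ≤ 2 * L * dist x z := by nlinarith [hL x hx]

end BoundedLipschitzOnWith

end BoundedLipschitz

/-! ### Coordinates in the plane -/

theorem dist_sq_eq (x y : Plane) : dist x y ^ 2 = (x 0 - y 0) ^ 2 + (x 1 - y 1) ^ 2 := by
  rw [EuclideanSpace.dist_eq, Real.sq_sqrt (by positivity), Fin.sum_univ_two, Real.dist_eq,
    Real.dist_eq, sq_abs, sq_abs]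

theorem norm_sq_eq (x : Plane) : ‖x‖ ^ 2 = x 0 ^ 2 + x 1 ^ 2 := by
  rw [EuclideanSpace.real_norm_sq_eq, Fin.sum_univ_two]

theorem inner_eq (x y : Plane) : inner ℝ x y = x 0 * y 0 + x 1 * y 1 := by
  rw [PiLp.inner_apply, Fin.sum_univ_two]
  simp [mul_comm]

theorem abs_coord_sub_le_dist (x y : Plane) (i : Fin 2) : |x i - y i| ≤ dist x y := by
  rw [dist_eq_norm]
  exact PiLp.norm_apply_le (x - y) i

/-- The horizontal line at height `h`, parametrised by arc length. -/
noncomputable def horizontal (h t : ℝ) : Plane := !₂[t, h]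

@[simp] theorem horizontal_zero (h t : ℝ) : horizontal h t 0 = t := by simp [horizontal]

@[simp] theorem horizontal_one (h t : ℝ) : horizontal h t 1 = h := by simp [horizontal]

theorem eq_horizontal (x : Plane) : x = horizontal (x 1) (x 0) := by
  ext i; fin_cases i <;> simp

@[fun_prop]
theorem continuous_horizontal : Continuous fun p : ℝ × ℝ => horizontal p.1 p.2 := by
  unfold horizontal; fun_prop

theorem isometry_horizontal (h : ℝ) : Isometry (horizontal h) := by
  refine Isometry.of_dist_eq fun s t => ?_
  rw [← sq_eq_sq₀ dist_nonneg dist_nonneg, dist_sq_eq, Real.dist_eq, sq_abs]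
  simp

theorem dist_horizontal_self (h : ℝ) (x : Plane) : dist x (horizontal h (x 0)) = |x 1 - h| := by
  rw [← sq_eq_sq₀ dist_nonneg (abs_nonneg _), dist_sq_eq, sq_abs]
  simp

theorem measurableEmbedding_horizontal (h : ℝ) : MeasurableEmbedding (horizontal h) :=
  (isometry_horizontal h).isClosedEmbedding.measurableEmbedding

theorem hausdorffMeasure_horizontal_image (h : ℝ) (s : Set ℝ) :
    Measure.hausdorffMeasure 1 (horizontal h '' s) = volume s := by
  rw [(isometry_horizontal h).hausdorffMeasure_image (Or.inl zero_le_one), hausdorffMeasure_real]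

theorem restrict_horizontal_image (h : ℝ) (s : Set ℝ) :
    (Measure.hausdorffMeasure 1).restrict (horizontal h '' s) =
      Measure.map (horizontal h) (volume.restrict s) := by
  have hvol : Measure.map (horizontal h) volume =
      (Measure.hausdorffMeasure 1).restrict (Set.range (horizontal h)) := by
    rw [← hausdorffMeasure_real, (isometry_horizontal h).map_hausdorffMeasure (.inl zero_le_one)]
  have hmap := (measurableEmbedding_horizontal h).restrict_map volume (horizontal h '' s)
  rwa [Set.preimage_image_eq _ (isometry_horizontal h).injective, hvol,
    Measure.restrict_restrict_of_subset (Set.image_subset_range _ _)] at hmap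

/-! ### The boundary of a Lipschitz domain -/

section LocalGraph

variable {Ω : Set Plane} {p x : Plane} {T : Plane ≃ₗᵢ[ℝ] Plane} {g : ℝ → ℝ} {r : ℝ}

theorem notMem_closure_of_graph_lt (hg : Continuous g)
    (hloc : ∀ x ∈ Metric.ball p r, x ∈ Ω ↔ (T (x - p)) 1 < g ((T (x - p)) 0))
    (hx : x ∈ Metric.ball p r) (hlt : g ((T (x - p)) 0) < (T (x - p)) 1) : x ∉ closure Ω := by
  have hg' : Continuous fun z : Plane => g ((T (z - p)) 0) := by fun_prop
  have hT : Continuous fun z : Plane => (T (z - p)) 1 := by fun_prop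
  rw [mem_closure_iff_frequently, not_frequently]
  filter_upwards [hg'.continuousAt.eventually_lt hT.continuousAt hlt,
    Metric.isOpen_ball.mem_nhds hx] with z hz hzr hzΩ
  exact hz.not_gt ((hloc z hzr).1 hzΩ)

theorem graph_eq_of_mem_frontier (hΩ : IsOpen Ω) (hg : Continuous g)
    (hloc : ∀ x ∈ Metric.ball p r, x ∈ Ω ↔ (T (x - p)) 1 < g ((T (x - p)) 0))
    (hx : x ∈ Metric.ball p r) (hxΩ : x ∈ frontier Ω) :
    (T (x - p)) 1 = g ((T (x - p)) 0) := by
  rw [hΩ.frontier_eq] at hxΩ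
  exact le_antisymm
    (not_lt.1 fun hlt => notMem_closure_of_graph_lt hg hloc hx hlt hxΩ.1)
    (not_lt.1 fun hlt => hxΩ.2 ((hloc x hx).2 hlt))

theorem coord_zero_ne_zero_of_segment_subset_graph {v : Plane} {m : ℝ} (hv : v ≠ 0) (hm : 0 < m)
    (hline : ∀ t, |t| < m → t * v 1 = g (t * v 0)) : v 0 ≠ 0 := by
  intro h0
  have hg0 := hline 0 (by simpa using hm)
  have hgm := hline (m / 2) (by rw [abs_of_pos (half_pos hm)]; exact half_lt_self hm)
  simp only [h0, mul_zero, zero_mul] at hg0 hgm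
  rw [← hg0, mul_eq_zero] at hgm
  refine hv ?_
  ext i; fin_cases i
  exacts [h0, hgm.resolve_left (half_pos hm).ne']

theorem lipschitzWith_graph {L : ℝ≥0} (hg : LipschitzWith L g) :
    LipschitzWith (1 + L) fun s : ℝ => horizontal (g s) s := by
  refine LipschitzWith.of_dist_le_mul fun s t => ?_
  have hgst := hg.dist_le_mul s t
  have hdist : dist (horizontal (g s) s) (horizontal (g t) t) ≤ dist s t + dist (g s) (g t) := by
    refine (abs_le_of_sq_le_sq' ?_ (by positivity)).2
    rw [dist_sq_eq]
    simp only [horizontal_zero, horizontal_one, ← sq_abs (_ - _ : ℝ), ← Real.dist_eq]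
    nlinarith [mul_nonneg (dist_nonneg (x := s) (y := t)) (dist_nonneg (x := g s) (y := g t))]
  push_cast
  linarith

theorem frontier_inter_ball_subset_image_graph (hΩ : IsOpen Ω) (hg : Continuous g)
    (hloc : ∀ x ∈ Metric.ball p r, x ∈ Ω ↔ (T (x - p)) 1 < g ((T (x - p)) 0)) :
    frontier Ω ∩ Metric.ball p r ⊆
      (fun s => T.symm (horizontal (g s) s) + p) '' Set.Ioo (-r) r := by
  rintro x ⟨hxΩ, hx⟩
  have habs : |(T (x - p)) 0| < r := calc
    |(T (x - p)) 0| ≤ ‖T (x - p)‖ := PiLp.norm_apply_le (T (x - p)) 0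
    _ = dist x p := by rw [T.norm_map, dist_eq_norm]
    _ < r := hx
  refine ⟨(T (x - p)) 0, abs_lt.1 habs, ?_⟩
  simp only [← graph_eq_of_mem_frontier hΩ hg hloc hx hxΩ, ← eq_horizontal, T.symm_apply_apply,
    sub_add_cancel]

end LocalGraph

namespace IsBoundedLipschitzDomain

variable {Ω : Set Plane}

theorem isCompact_frontier (hΩ : IsBoundedLipschitzDomain Ω) : IsCompact (frontier Ω) :=
  Metric.isCompact_of_isClosed_isBounded isClosed_frontier
    (hΩ.isBounded.closure.subset frontier_subset_closure)

theorem hausdorffMeasure_frontier_lt_top (hΩ : IsBoundedLipschitzDomain Ω) :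
    Measure.hausdorffMeasure 1 (frontier Ω) < ∞ := by
  refine hΩ.isCompact_frontier.measure_lt_top_of_nhdsWithin fun p hp => ?_
  obtain ⟨T, g, L, r, hg, hr, hloc⟩ := hΩ.local_graph p hp
  refine ⟨frontier Ω ∩ Metric.ball p r,
    inter_mem self_mem_nhdsWithin (mem_nhdsWithin_of_mem_nhds (Metric.ball_mem_nhds p hr)), ?_⟩
  have hG : LipschitzWith (1 + L) fun s : ℝ => T.symm (horizontal (g s) s) + p := by
    have := (isometry_add_right p).lipschitz.comp
      (T.symm.isometry.lipschitz.comp (lipschitzWith_graph hg))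
    simpa only [one_mul, Function.comp_def] using this
  calc Measure.hausdorffMeasure 1 (frontier Ω ∩ Metric.ball p r)
      ≤ _ := measure_mono (frontier_inter_ball_subset_image_graph hΩ.isOpen hg.continuous hloc)
    _ ≤ _ := hG.hausdorffMeasure_image_le zero_le_one _
    _ < ∞ := by
      rw [hausdorffMeasure_real, Real.volume_Ioo]
      exact ENNReal.mul_lt_top (by simp) ENNReal.ofReal_lt_top

theorem frontier_subset_closure_exterior (hΩ : IsBoundedLipschitzDomain Ω) :
    frontier Ω ⊆ closure (closure Ω)ᶜ := by
  intro p hp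
  obtain ⟨T, g, L, r, hg, hr, hloc⟩ := hΩ.local_graph p hp
  have hg0 : g 0 = 0 := by
    simpa using (graph_eq_of_mem_frontier hΩ.isOpen hg.continuous hloc
      (Metric.mem_ball_self hr) hp).symm
  have hcont : Continuous fun s : ℝ => p + s • T.symm (horizontal 1 0) := by fun_prop
  have htend := (hcont.tendsto' 0 p (by simp)).mono_left (nhdsWithin_le_nhds (s := Set.Ioi 0))
  refine mem_closure_of_tendsto htend ?_
  filter_upwards [htend (Metric.ball_mem_nhds p hr), self_mem_nhdsWithin] with s hball hs
  refine notMem_closure_of_graph_lt hg.continuous hloc hball ?_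
  simpa [hg0] using hs

theorem eventually_mem_frontier_imp_coord_eq (hΩ : IsBoundedLipschitzDomain Ω) {h w : ℝ}
    (hw : 0 < w) (hseg : ∀ t, |t| < w → horizontal h t ∈ frontier Ω) :
    ∀ᶠ x in 𝓝 (horizontal h 0), x ∈ frontier Ω → x 1 = h := by
  set p := horizontal h 0
  obtain ⟨T, g, L, r, hg, hr, hloc⟩ := hΩ.local_graph p (hseg 0 (by simpa using hw))
  set v := T (horizontal 0 1) with hv
  have hsub : ∀ t, horizontal h t - p = t • horizontal 0 1 := fun t => by
    ext i; fin_cases i <;> simp [p]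
  have hline : ∀ t, |t| < min w r → t * v 1 = g (t * v 0) := fun t ht => by
    have hball : horizontal h t ∈ Metric.ball p r := by
      rw [Metric.mem_ball, (isometry_horizontal h).dist_eq, Real.dist_eq, sub_zero]
      exact ht.trans_le (min_le_right _ _)
    have := graph_eq_of_mem_frontier hΩ.isOpen hg.continuous hloc hball
      (hseg t (ht.trans_le (min_le_left _ _)))
    simpa [hsub, ← hv] using this
  have hv0 : v 0 ≠ 0 := by
    refine coord_zero_ne_zero_of_segment_subset_graph ?_ (lt_min hw hr) hline
    rw [hv, ← norm_ne_zero_iff, T.norm_map, norm_ne_zero_iff]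
    intro h0
    simpa using congrArg (fun y : Plane => y 0) h0
  have hcont : Continuous fun x : Plane => |(T (x - p)) 0 / v 0| := by fun_prop
  filter_upwards [(hcont.tendsto p).eventually_lt_const (u := min w r) (by simpa using ⟨hw, hr⟩),
    Metric.ball_mem_nhds p hr] with x hx hball hxΩ
  set t := (T (x - p)) 0 / v 0
  have h0 : (T (x - p)) 0 = t * v 0 := (div_mul_cancel₀ _ hv0).symm
  have hT : T (x - p) = T (t • horizontal 0 1) := by
    have h1 := graph_eq_of_mem_frontier hΩ.isOpen hg.continuous hloc hball hxΩ
    rw [h0, ← hline t hx] at h1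
    rw [map_smul, ← hv]
    ext i; fin_cases i
    exacts [h0, h1]
  have hx1 := congrArg (fun y : Plane => y 1) (T.injective hT)
  simpa [p, sub_eq_zero] using hx1

end IsBoundedLipschitzDomain

/-! ### The outward normal along a flat piece of the boundary -/

theorem IsOutwardUnitNormal.eventually_ray {Ω : Set Plane} {y ν v : Plane}
    (h : IsOutwardUnitNormal Ω y ν) (hv : 0 < inner ℝ v ν) :
    ∀ᶠ s : ℝ in 𝓝[>] 0, y + s • v ∉ Ω ∧ y - s • v ∈ Ω := by
  have hv0 : 0 < ‖v‖ := norm_pos_iff.2 fun h0 => by simp [h0] at hv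
  obtain ⟨ε, hε, hεv⟩ : ∃ ε : ℝ, 0 < ε ∧ ε * ‖v‖ < inner ℝ v ν :=
    ⟨inner ℝ v ν / (2 * ‖v‖), by positivity, by field_simp; linarith⟩
  have hadd : Tendsto (fun s : ℝ => y + s • v) (𝓝[>] 0) (𝓝 y) :=
    ((by fun_prop : Continuous fun s : ℝ => y + s • v).tendsto' 0 y (by simp)).mono_left
      nhdsWithin_le_nhds
  have hsub : Tendsto (fun s : ℝ => y - s • v) (𝓝[>] 0) (𝓝 y) :=
    ((by fun_prop : Continuous fun s : ℝ => y - s • v).tendsto' 0 y (by simp)).mono_left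
      nhdsWithin_le_nhds
  filter_upwards [hadd.eventually (h.2 ε hε), hsub.eventually (h.2 ε hε), self_mem_nhdsWithin]
    with s hout hin (hs : 0 < s)
  have hcone : ε * ‖s • v‖ < inner ℝ (s • v) ν := by
    rw [norm_smul, real_inner_smul_left, Real.norm_of_nonneg hs.le]
    nlinarith
  refine ⟨hout.1 (by rwa [add_sub_cancel_left]), hin.2 ?_⟩
  rw [sub_sub_cancel_left, norm_neg, inner_neg_left]
  exact neg_lt_neg hcone

theorem IsOutwardUnitNormal.unique {Ω : Set Plane} {y ν ν' : Plane}
    (h : IsOutwardUnitNormal Ω y ν) (h' : IsOutwardUnitNormal Ω y ν') : ν = ν' := by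
  by_contra hne
  have hinner : inner ℝ ν ν' < 1 := (inner_lt_one_iff_real_of_norm_eq_one h.1 h'.1).2 hne
  have hacute : 0 < inner ℝ (ν - ν') ν := by
    rw [inner_sub_left, real_inner_self_eq_norm_sq, h.1, real_inner_comm]; linarith
  have hobtuse : 0 < inner ℝ (ν' - ν) ν' := by
    rw [inner_sub_left, real_inner_self_eq_norm_sq, h'.1]; linarith
  obtain ⟨s, ⟨hout, -⟩, -, hin⟩ :=
    ((h.eventually_ray hacute).and (h'.eventually_ray hobtuse)).exists
  refine hout ?_
  rwa [← neg_sub ν ν', smul_neg, sub_neg_eq_add] at hin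

theorem IsOutwardUnitNormal.outwardNormal_eq {Ω : Set Plane} {y ν : Plane}
    (h : IsOutwardUnitNormal Ω y ν) : outwardNormal Ω y = ν := by
  have hex : ∃ ν, IsOutwardUnitNormal Ω y ν := ⟨ν, h⟩
  rw [outwardNormal, dif_pos hex]
  exact hex.choose_spec.unique h

theorem subset_or_disjoint_of_isPreconnected {X : Type*} [TopologicalSpace X] {Ω U : Set X}
    (hΩ : IsOpen Ω) (hU : IsPreconnected U) (hd : Disjoint U (frontier Ω)) :
    U ⊆ Ω ∨ Disjoint U Ω := by
  refine (hU.subset_or_subset hΩ isClosed_closure.isOpen_compl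
    (disjoint_compl_right.mono_left subset_closure) fun x hx => ?_).imp_right fun h =>
      (Set.disjoint_compl_left_iff_subset.2 subset_closure).mono_left h
  by_contra! hx'
  rw [Set.mem_union, not_or, Set.notMem_compl_iff] at hx'
  exact hd.notMem_of_mem_left hx (hΩ.frontier_eq ▸ ⟨hx'.2, hx'.1⟩)

/-- The open rectangle of width `2 * w` and depth `d` that rests on the line at height `h`, above
it for `σ = 1` and below it for `σ = -1`. -/
def flatSide (h w d σ : ℝ) : Set Plane :=
  {x | |x 0| < w ∧ 0 < σ * (x 1 - h) ∧ σ * (x 1 - h) < d}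

theorem sq_eq_one_of_sign {σ : ℝ} (hσ : σ = 1 ∨ σ = -1) : σ * σ = 1 := by
  rcases hσ with rfl | rfl <;> norm_num

theorem isPreconnected_flatSide {h w d σ : ℝ} (hσ : σ = 1 ∨ σ = -1) :
    IsPreconnected (flatSide h w d σ) := by
  have himage : flatSide h w d σ =
      (fun p : ℝ × ℝ => horizontal (h + σ * p.2) p.1) '' Set.Ioo (-w) w ×ˢ Set.Ioo 0 d := by
    ext x
    constructor
    · rintro ⟨h0, h1⟩
      refine ⟨(x 0, σ * (x 1 - h)), ⟨abs_lt.1 h0, h1⟩, ?_⟩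
      simp only [← mul_assoc, sq_eq_one_of_sign hσ, one_mul, add_sub_cancel, ← eq_horizontal]
    · rintro ⟨p, ⟨h0, h1⟩, rfl⟩
      simpa [flatSide, ← mul_assoc, sq_eq_one_of_sign hσ, abs_lt] using And.intro h0 h1
  rw [himage]
  exact (isPreconnected_Ioo.prod isPreconnected_Ioo).image _ (by fun_prop)

theorem eventually_abs_coord_lt {h w d t : ℝ} (ht : |t| < w) (hd : 0 < d) :
    ∀ᶠ x in 𝓝 (horizontal h t), |x 0| < w ∧ |x 1 - h| < d := by
  have h0 : Continuous fun x : Plane => |x 0| := by fun_prop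
  have h1 : Continuous fun x : Plane => |x 1 - h| := by fun_prop
  exact ((h0.tendsto _).eventually_lt_const (by simpa using ht)).and
    ((h1.tendsto _).eventually_lt_const (by simpa using hd))

theorem outwardNormal_horizontal_eq {Ω : Set Plane} {h w d t σ : ℝ} (hσ : σ = 1 ∨ σ = -1)
    (ht : |t| < w) (hd : 0 < d) (hout : Disjoint (flatSide h w d σ) Ω)
    (hin : flatSide h w d (-σ) ⊆ Ω) : outwardNormal Ω (horizontal h t) = horizontal σ 0 := by
  refine IsOutwardUnitNormal.outwardNormal_eq ⟨?_, fun ε hε => ?_⟩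
  · rw [← sq_eq_sq₀ (norm_nonneg _) zero_le_one, norm_sq_eq]
    simp [sq, sq_eq_one_of_sign hσ]
  · filter_upwards [eventually_abs_coord_lt ht hd] with z ⟨hz0, hz1⟩
    have hheight : inner ℝ (z - horizontal h t) (horizontal σ 0) = σ * (z 1 - h) := by
      rw [inner_eq]; simp [mul_comm]
    have hlt : |σ * (z 1 - h)| < d := by
      rw [abs_mul]; rcases hσ with rfl | rfl <;> simpa using hz1
    have hcone : 0 ≤ ε * ‖z - horizontal h t‖ := by positivity
    rw [hheight]
    refine ⟨fun h1 => hout.notMem_of_mem_left ⟨hz0, by linarith, (abs_lt.1 hlt).2⟩,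
      fun h1 => hin ⟨hz0, ?_, ?_⟩⟩
    · linarith
    · linarith [(abs_lt.1 hlt).1]

theorem exists_mem_flatSide {U : Set Plane} (hU : IsOpen U) {h w d t : ℝ} (ht : |t| < w)
    (hd : 0 < d) (hcl : horizontal h t ∈ closure U) :
    ∃ σ : ℝ, (σ = 1 ∨ σ = -1) ∧ (flatSide h w d σ ∩ U).Nonempty := by
  obtain ⟨p, hpU, hp0, hp1⟩ :=
    ((mem_closure_iff_frequently.1 hcl).and_eventually (eventually_abs_coord_lt ht hd)).exists
  rcases lt_trichotomy (p 1) h with hlt | rfl | hgt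
  · exact ⟨-1, .inr rfl, p, ⟨hp0, by linarith, by linarith [(abs_lt.1 hp1).1]⟩, hpU⟩
  · have hcont : Continuous fun s : ℝ => horizontal (p 1 + s) (p 0) := by fun_prop
    have hmem : ∀ᶠ s in 𝓝[>] (0 : ℝ), horizontal (p 1 + s) (p 0) ∈ U :=
      ((hcont.tendsto' 0 p (by rw [add_zero, ← eq_horizontal])).mono_left
        nhdsWithin_le_nhds).eventually (hU.mem_nhds hpU)
    obtain ⟨s, hsU, hsd, hs : 0 < s⟩ := (hmem.and
      ((eventually_nhdsWithin_of_eventually_nhds (Iio_mem_nhds hd)).and self_mem_nhdsWithin)).exists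
    exact ⟨1, .inl rfl, _, ⟨by simpa using hp0, by simpa using hs, by simpa using hsd⟩, hsU⟩
  · exact ⟨1, .inl rfl, p, ⟨hp0, by linarith, by linarith [(abs_lt.1 hp1).2]⟩, hpU⟩

/-- The boundary of `Ω` contains the segment `(-w, w) × {h}`, and stays at distance at least `d`
from this segment outside the line at height `h`. -/
structure IsFlatPiece (Ω : Set Plane) (h w d : ℝ) : Prop where
  pos : 0 < d
  segment : ∀ t, |t| < w → horizontal h t ∈ frontier Ω
  far : ∀ x ∈ frontier Ω, x 1 ≠ h → ∀ t, |t| < w → d ≤ dist x (horizontal h t)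

theorem IsFlatPiece.disjoint_flatSide {Ω : Set Plane} {h w d σ : ℝ} (hF : IsFlatPiece Ω h w d)
    (hσ : σ = 1 ∨ σ = -1) : Disjoint (flatSide h w d σ) (frontier Ω) := by
  refine Set.disjoint_left.2 fun x ⟨hx0, hx1, hxd⟩ hxΩ => ?_
  have hne : x 1 ≠ h := fun h0 => by simp [h0] at hx1
  have hfar := hF.far x hxΩ hne (x 0) hx0
  have habs : |x 1 - h| = σ * (x 1 - h) := by
    rcases hσ with rfl | rfl
    · rw [abs_of_pos] <;> linarith
    · rw [abs_of_neg] <;> linarith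
  rw [dist_horizontal_self, habs] at hfar
  exact hfar.not_gt hxd

theorem IsBoundedLipschitzDomain.exists_isFlatPiece {Ω : Set Plane} {h w : ℝ}
    (hΩ : IsBoundedLipschitzDomain Ω) (hw : 0 < w)
    (hseg : ∀ t, |t| < w → horizontal h t ∈ frontier Ω) :
    ∃ w' d, 0 < w' ∧ IsFlatPiece Ω h w' d := by
  obtain ⟨ρ, hρ, hball⟩ :=
    Metric.eventually_nhds_iff_ball.1 (hΩ.eventually_mem_frontier_imp_coord_eq hw hseg)
  refine ⟨min w (ρ / 2), ρ / 2, lt_min hw (half_pos hρ), half_pos hρ,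
    fun t ht => hseg t (ht.trans_le (min_le_left _ _)), fun x hx hxh t ht => ?_⟩
  have hfar : ρ ≤ dist x (horizontal h 0) := not_lt.1 fun hlt => hxh (hball x hlt hx)
  have hcenter : dist (horizontal h t) (horizontal h 0) < ρ / 2 := by
    rw [(isometry_horizontal h).dist_eq, Real.dist_eq, sub_zero]
    exact ht.trans_le (min_le_right _ _)
  linarith [dist_triangle x (horizontal h t) (horizontal h 0)]

theorem IsBoundedLipschitzDomain.exists_outwardNormal_eq {Ω : Set Plane} {h w d : ℝ}
    (hΩ : IsBoundedLipschitzDomain Ω) (hw : 0 < w) (hF : IsFlatPiece Ω h w d) :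
    ∃ σ : ℝ, (σ = 1 ∨ σ = -1) ∧
      ∀ t, |t| < w → outwardNormal Ω (horizontal h t) = horizontal σ 0 := by
  have h0 : |(0 : ℝ)| < w := by simpa using hw
  have hfr := hF.segment 0 h0
  have hdich : ∀ {σ : ℝ}, σ = 1 ∨ σ = -1 →
      flatSide h w d σ ⊆ Ω ∨ Disjoint (flatSide h w d σ) Ω := fun hσ =>
    subset_or_disjoint_of_isPreconnected hΩ.isOpen (isPreconnected_flatSide hσ)
      (hF.disjoint_flatSide hσ)
  obtain ⟨τ, hτ, x, hxτ, hxΩ⟩ :=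
    exists_mem_flatSide hΩ.isOpen h0 hF.pos (frontier_subset_closure hfr)
  obtain ⟨σ, hσ, z, hzσ, hzΩ⟩ := exists_mem_flatSide isClosed_closure.isOpen_compl h0 hF.pos
    (hΩ.frontier_subset_closure_exterior hfr)
  have hin : flatSide h w d τ ⊆ Ω :=
    (hdich hτ).resolve_right fun hdis => hdis.notMem_of_mem_left hxτ hxΩ
  have hout : Disjoint (flatSide h w d σ) Ω :=
    (hdich hσ).resolve_left fun hsub => hzΩ (subset_closure (hsub hzσ))
  have hτσ : τ = -σ := by
    have hne : τ ≠ σ := fun heq => hout.notMem_of_mem_left hzσ (hin (heq ▸ hzσ))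
    grind
  exact ⟨σ, hσ, fun t ht => outwardNormal_horizontal_eq hσ ht hF.pos hout (hτσ ▸ hin)⟩

/-! ### Bounds for the `H^{1/2}` norm -/

theorem lintegral_arcLength_le {Ω : Set Plane} {f : Plane → ℝ≥0∞} {c : ℝ≥0∞}
    (hf : ∀ x ∈ frontier Ω, f x ≤ c) :
    ∫⁻ x, f x ∂(arcLength Ω) ≤ c * Measure.hausdorffMeasure 1 (frontier Ω) :=
  (setLIntegral_mono' isClosed_frontier.measurableSet hf).trans_eq (setLIntegral_const _ _)

namespace BoundedLipschitzOnWith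

variable {Ω : Set Plane} {h : Plane → ℂ} {L : ℝ}

theorem hHalfNorm_le (H : BoundedLipschitzOnWith L h (frontier Ω)) :
    hHalfNorm Ω h ≤
      ENNReal.ofReal L * (1 + Measure.hausdorffMeasure 1 (frontier Ω)) := by
  set m := Measure.hausdorffMeasure 1 (frontier Ω)
  set ℓ := ENNReal.ofReal L
  have hL2 : ∫⁻ x, ‖h x‖ₑ ^ 2 ∂(arcLength Ω) ≤ ℓ ^ 2 * m :=
    lintegral_arcLength_le fun x hx => by
      rw [← ofReal_norm]; gcongr; exact ENNReal.ofReal_le_ofReal (H.norm_le x hx)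
  have hdouble : ∫⁻ x, ∫⁻ z, ‖h x - h z‖ₑ ^ 2 / edist x z ^ 2 ∂(arcLength Ω) ∂(arcLength Ω) ≤
      ℓ ^ 2 * m * m :=
    lintegral_arcLength_le fun x hx => lintegral_arcLength_le fun z hz => by
      refine ENNReal.div_le_of_le_mul ?_
      rw [← mul_pow, ← ofReal_norm, edist_dist, ← ENNReal.ofReal_mul' dist_nonneg]
      gcongr
      exact H.norm_sub_le x hx z hz
  calc hHalfNorm Ω h ≤ (ℓ ^ 2 * m + ℓ ^ 2 * m * m) ^ (1 / 2 : ℝ) := by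
        rw [hHalfNorm]; gcongr
    _ ≤ ((ℓ * (1 + m)) ^ 2) ^ (1 / 2 : ℝ) := by
        gcongr
        calc ℓ ^ 2 * m + ℓ ^ 2 * m * m ≤ ℓ ^ 2 * m + ℓ ^ 2 * m * m + (ℓ ^ 2 + ℓ ^ 2 * m) :=
              le_self_add
          _ = (ℓ * (1 + m)) ^ 2 := by ring
    _ = ℓ * (1 + m) := by simpa using ENNReal.pow_rpow_inv_natCast two_ne_zero (ℓ * (1 + m))

theorem memHHalf (hΩ : IsBoundedLipschitzDomain Ω)
    (H : BoundedLipschitzOnWith L h (frontier Ω)) : MemHHalf Ω h := by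
  constructor
  · have hlip : LipschitzOnWith L.toNNReal h (frontier Ω) :=
      LipschitzOnWith.of_dist_le_mul fun x hx z hz => by
        rw [dist_eq_norm]
        exact (H.norm_sub_le x hx z hz).trans (by gcongr; exact Real.le_coe_toNNReal L)
    exact hlip.continuousOn.aestronglyMeasurable isClosed_frontier.measurableSet
  · refine H.hHalfNorm_le.trans_lt (ENNReal.mul_lt_top ENNReal.ofReal_lt_top ?_)
    exact ENNReal.add_lt_top.2 ⟨ENNReal.one_lt_top, hΩ.hausdorffMeasure_frontier_lt_top⟩

end BoundedLipschitzOnWith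

theorem le_hHalfNorm {Ω : Set Plane} {φ : Plane → ℂ} {h a b : ℝ}
    (hfr : ∀ t, |t| ≤ a → horizontal h t ∈ frontier Ω)
    (hφ : ∀ t, |t| ≤ a → b ≤ ‖φ (horizontal h t)‖) :
    ENNReal.ofReal b * ENNReal.ofReal (2 * a) ^ (1 / 2 : ℝ) ≤ hHalfNorm Ω φ := by
  set S := horizontal h '' Set.Icc (-a) a with hS
  have hSm : MeasurableSet S :=
    (measurableEmbedding_horizontal h).measurableSet_image.2 measurableSet_Icc
  have hSfr : S ⊆ frontier Ω := Set.image_subset_iff.2 fun t ht => hfr t (abs_le.2 ht)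
  have hL2 : ENNReal.ofReal b ^ 2 * ENNReal.ofReal (2 * a) ≤
      ∫⁻ x, ‖φ x‖ₑ ^ 2 ∂(arcLength Ω) := calc
    _ = ∫⁻ _ in S, ENNReal.ofReal b ^ 2 ∂(Measure.hausdorffMeasure 1) := by
        rw [setLIntegral_const, hS, hausdorffMeasure_horizontal_image, Real.volume_Icc,
          sub_neg_eq_add, two_mul]
    _ ≤ ∫⁻ x in S, ‖φ x‖ₑ ^ 2 ∂(Measure.hausdorffMeasure 1) := by
        refine setLIntegral_mono' hSm ?_
        rintro _ ⟨t, ht, rfl⟩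
        rw [← ofReal_norm]
        gcongr
        exact hφ t (abs_le.2 ht)
    _ ≤ ∫⁻ x, ‖φ x‖ₑ ^ 2 ∂(arcLength Ω) :=
        lintegral_mono' (Measure.restrict_mono hSfr le_rfl) le_rfl
  calc ENNReal.ofReal b * ENNReal.ofReal (2 * a) ^ (1 / 2 : ℝ)
      = (ENNReal.ofReal b ^ 2 * ENNReal.ofReal (2 * a)) ^ (1 / 2 : ℝ) := by
        rw [ENNReal.mul_rpow_of_nonneg _ _ (by norm_num)]
        congr 1
        simpa using (ENNReal.pow_rpow_inv_natCast two_ne_zero (ENNReal.ofReal b)).symm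
    _ ≤ hHalfNorm Ω φ := by
        rw [hHalfNorm]
        gcongr
        exact hL2.trans le_self_add

/-! ### Absolutely convergent Neumann–Poincaré integrals -/

/-- The integral `∫ k(x,y) φ(y) ds(y)` converges absolutely, with value `l`. -/
def HasNPIntegral (Ω : Set Plane) (φ : Plane → ℂ) (x : Plane) (l : ℂ) : Prop :=
  Integrable (fun y => (npKernel Ω x y : ℂ) * φ y) (arcLength Ω) ∧
    ∫ y, (npKernel Ω x y : ℂ) * φ y ∂(arcLength Ω) = l

theorem tendsto_integral_truncation {X E : Type*} [PseudoMetricSpace X] [MeasurableSpace X]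
    [OpensMeasurableSpace X] [NormedAddCommGroup E] [NormedSpace ℝ E] {μ : Measure X} {F : X → E}
    (hF : Integrable F μ) {x : X} (hx : ∀ y, dist x y = 0 → F y = 0) :
    Tendsto (fun ε : ℝ => ∫ y in {y | ε ≤ dist x y}, F y ∂μ) (𝓝[>] 0) (𝓝 (∫ y, F y ∂μ)) := by
  have hm : ∀ ε : ℝ, MeasurableSet {y | ε ≤ dist x y} := fun ε =>
    (isClosed_le continuous_const (by fun_prop)).measurableSet
  simp_rw [fun ε => (integral_indicator (μ := μ) (f := F) (hm ε)).symm]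
  refine tendsto_integral_filter_of_dominated_convergence (fun y => ‖F y‖)
    (Eventually.of_forall fun ε => hF.aestronglyMeasurable.indicator (hm ε))
    (Eventually.of_forall fun ε => Eventually.of_forall fun y => norm_indicator_le_norm_self _ _)
    hF.norm (Eventually.of_forall fun y => ?_)
  rcases (dist_nonneg (x := x) (y := y)).eq_or_lt with h0 | h0
  · have : ∀ ε : ℝ, {y | ε ≤ dist x y}.indicator F y = F y := fun ε => by
      rw [Set.indicator_apply, hx y h0.symm]; simp
    simp [this]
  · refine tendsto_const_nhds.congr' ?_
    filter_upwards [nhdsWithin_le_nhds (Iio_mem_nhds h0)] with ε hε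
    rw [Set.indicator_of_mem]
    exact (Set.mem_Iio.1 hε).le

theorem HasNPIntegral.tendsto {Ω : Set Plane} {φ : Plane → ℂ} {x : Plane} {l : ℂ}
    (h : HasNPIntegral Ω φ x l) : Tendsto (npTrunc Ω φ x) (𝓝[>] 0) (𝓝 l) := by
  rw [← h.2]
  refine tendsto_integral_truncation h.1 fun y hy => ?_
  rw [dist_eq_norm] at hy
  simp [npKernel, hy]

theorem HasNPIntegral.npExists {Ω : Set Plane} {φ : Plane → ℂ} {x : Plane} {l : ℂ}
    (h : HasNPIntegral Ω φ x l) : NPExists Ω φ x :=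
  ⟨fun _ _ => h.1.integrableOn, l, h.tendsto⟩

theorem HasNPIntegral.npOperator_eq {Ω : Set Plane} {φ : Plane → ℂ} {x : Plane} {l : ℂ}
    (h : HasNPIntegral Ω φ x l) : npOperator Ω φ x = l :=
  h.tendsto.limUnder_eq

theorem HasNPIntegral.add {Ω : Set Plane} {φ ψ : Plane → ℂ} {x : Plane} {l m : ℂ}
    (h : HasNPIntegral Ω φ x l) (h' : HasNPIntegral Ω ψ x m) :
    HasNPIntegral Ω (fun y => φ y + ψ y) x (l + m) := by
  simp only [HasNPIntegral, mul_add]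
  exact ⟨h.1.add h'.1, by rw [integral_add h.1 h'.1, h.2, h'.2]⟩

/-- A Lipschitz density whose Neumann–Poincaré integral converges absolutely everywhere, to a
function `u` that is Lipschitz on the boundary: all that is needed to stay within `H^{1/2}`. -/
structure HasRegularPotential (Ω : Set Plane) (φ u : Plane → ℂ) : Prop where
  density : ∃ L, BoundedLipschitzOnWith L φ (frontier Ω)
  hasNPIntegral : ∀ x, HasNPIntegral Ω φ x (u x)
  potential : ∃ L, BoundedLipschitzOnWith L u (frontier Ω)

theorem HasRegularPotential.add {Ω : Set Plane} {φ ψ u v : Plane → ℂ}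
    (hφ : HasRegularPotential Ω φ u) (hψ : HasRegularPotential Ω ψ v) :
    HasRegularPotential Ω (fun x => φ x + ψ x) (fun x => u x + v x) := by
  obtain ⟨⟨L, hL⟩, hint, M, hM⟩ := hφ
  obtain ⟨⟨L', hL'⟩, hint', M', hM'⟩ := hψ
  exact ⟨⟨L + L', hL.add hL'⟩, fun x => (hint x).add (hint' x), M + M', hM.add hM'⟩

theorem HasRegularPotential.npOperator_eq {Ω : Set Plane} {φ u : Plane → ℂ}
    (h : HasRegularPotential Ω φ u) : npOperator Ω φ = u :=
  funext fun x => (h.hasNPIntegral x).npOperator_eq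

/-- The density `φ` lies in `H^{1/2}(∂Ω)` and is not zero there, `K φ` exists almost everywhere,
and `lam φ - K φ` lies in `H^{1/2}(∂Ω)`. -/
def IsAdmissible (Ω : Set Plane) (lam : ℝ) (φ : Plane → ℂ) : Prop :=
  MemHHalf Ω φ ∧ hHalfNorm Ω φ ≠ 0 ∧ (∀ᵐ x ∂(arcLength Ω), NPExists Ω φ x) ∧
    MemHHalf Ω (fun x => (lam : ℂ) * φ x - npOperator Ω φ x)

theorem HasRegularPotential.isAdmissible {Ω : Set Plane} {φ u : Plane → ℂ}
    (h : HasRegularPotential Ω φ u) (hΩ : IsBoundedLipschitzDomain Ω) (hφ : hHalfNorm Ω φ ≠ 0)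
    (lam : ℝ) : IsAdmissible Ω lam φ := by
  obtain ⟨L, hL⟩ := h.density
  obtain ⟨M, hM⟩ := h.potential
  refine ⟨hL.memHHalf hΩ, hφ, .of_forall fun x => (h.hasNPIntegral x).npExists, ?_⟩
  rw [h.npOperator_eq]
  exact ((hL.const_mul (lam : ℂ)).sub hM).memHHalf hΩ

/-! ### Densities supported on a flat piece of the boundary -/

/-- The density on the line at height `h` with profile `f`. -/
noncomputable def layer (h : ℝ) (f : ℝ → ℂ) (x : Plane) : ℂ :=
  open Classical in if x 1 = h then f (x 0) else 0

theorem layer_of_eq {h : ℝ} {f : ℝ → ℂ} {x : Plane} (hx : x 1 = h) : layer h f x = f (x 0) :=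
  if_pos hx

theorem layer_of_ne {h : ℝ} {f : ℝ → ℂ} {x : Plane} (hx : x 1 ≠ h) : layer h f x = 0 :=
  if_neg hx

/-- The double layer kernel `v₂ / |v|²`, `v = (t, h) - x`, of the line at height `h` with normal
`(0, 1)`, up to the factor `1 / 2π`. -/
noncomputable def flatKernel (h : ℝ) (x : Plane) (t : ℝ) : ℝ :=
  (h - x 1) / ((t - x 0) ^ 2 + (h - x 1) ^ 2)

/-- The double layer potential, up to the factor `1 / 2π`, of the density `layer h f` on the line
at height `h` with normal `(0, 1)`. -/
noncomputable def potential (h : ℝ) (f : ℝ → ℂ) (x : Plane) : ℂ :=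
  ∫ t, (flatKernel h x t : ℂ) * f t

theorem flatKernel_of_eq {h : ℝ} {x : Plane} (hx : x 1 = h) (t : ℝ) : flatKernel h x t = 0 := by
  simp [flatKernel, hx]

theorem potential_of_eq {h : ℝ} {f : ℝ → ℂ} {x : Plane} (hx : x 1 = h) : potential h f x = 0 := by
  simp [potential, flatKernel_of_eq hx]

theorem flatKernel_eq_div_dist (h : ℝ) (x : Plane) (t : ℝ) :
    flatKernel h x t = (h - x 1) / dist x (horizontal h t) ^ 2 := by
  rw [dist_sq_eq, flatKernel, horizontal_zero, horizontal_one, ← sub_sq_comm t, ← sub_sq_comm h]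

theorem continuous_flatKernel (h : ℝ) (x : Plane) : Continuous (flatKernel h x) := by
  rcases eq_or_ne (x 1) h with hx | hx
  · simp_rw [funext (flatKernel_of_eq hx)]
    exact continuous_const
  · have hpos : 0 < (h - x 1) ^ 2 := sq_pos_of_ne_zero (sub_ne_zero.2 hx.symm)
    exact continuous_const.div (by fun_prop) fun t =>
      (add_pos_of_nonneg_of_pos (sq_nonneg _) hpos).ne'

theorem abs_flatKernel_le {h ρ : ℝ} (hρ : 0 < ρ) {x : Plane} {t : ℝ}
    (hd : ρ ≤ dist x (horizontal h t)) : |flatKernel h x t| ≤ |h - x 1| / ρ ^ 2 := by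
  rw [flatKernel_eq_div_dist, abs_div, abs_of_nonneg (sq_nonneg (dist _ _))]
  gcongr

theorem abs_flatKernel_sub_le {h ρ : ℝ} (hρ : 0 < ρ) {x z : Plane} {t : ℝ}
    (hx : ρ ≤ dist x (horizontal h t)) (hz : ρ ≤ dist z (horizontal h t)) :
    |flatKernel h x t - flatKernel h z t| ≤ dist x z / ρ ^ 2 := by
  have hne : ∀ y : Plane, ρ ≤ dist y (horizontal h t) → horizontal h t - y ≠ 0 := fun y hy h0 => by
    rw [dist_comm, dist_eq_norm, h0, norm_zero] at hy
    exact hρ.not_ge hy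
  -- The kernel is a coordinate of the inversion `v ↦ v / |v|²`, which distorts distances by the
  -- factor `1 / (|v| |v'|)`.
  have hinv : ∀ y : Plane, flatKernel h y t =
      ((1 / ‖horizontal h t - y‖) ^ 2 • (horizontal h t - y)) 1 := fun y => by
    rw [flatKernel_eq_div_dist, dist_comm, dist_eq_norm, PiLp.smul_apply, PiLp.sub_apply,
      horizontal_one, smul_eq_mul, one_div, inv_pow, ← div_eq_inv_mul]
  rw [hinv x, hinv z]
  refine (abs_coord_sub_le_dist _ _ 1).trans ?_
  rw [dist_div_norm_sq_smul (hne x hx) (hne z hz) 1, dist_sub_left, ← dist_eq_norm,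
    ← dist_eq_norm, dist_comm _ x, dist_comm _ z, one_pow, div_mul_eq_mul_div, one_mul, sq]
  gcongr

theorem boundedLipschitzOnWith_flatKernel {h ρ B t : ℝ} (hρ : 0 < ρ) {A : Set Plane}
    (hB : ∀ x ∈ A, |h - x 1| ≤ B) (hA : ∀ x ∈ A, x 1 = h ∨ ρ ≤ dist x (horizontal h t)) :
    BoundedLipschitzOnWith ((B + 1) / ρ ^ 2) (fun x => flatKernel h x t) A := by
  have hline : ∀ x z : Plane, x 1 = h → ρ ≤ dist z (horizontal h t) →
      |flatKernel h z t| ≤ dist x z / ρ ^ 2 := fun x z hx hz => by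
    refine (abs_flatKernel_le hρ hz).trans ?_
    gcongr
    exact hx ▸ abs_coord_sub_le_dist x z 1
  have hB0 : ∀ x ∈ A, 0 ≤ B := fun x hx => (abs_nonneg _).trans (hB x hx)
  refine ⟨fun x hx => ?_, fun x hx z hz => ?_⟩
  · have hBx := hB0 x hx
    rw [Real.norm_eq_abs]
    rcases hA x hx with hxh | hxd
    · rw [flatKernel_of_eq hxh, abs_zero]; positivity
    · refine (abs_flatKernel_le hρ hxd).trans ?_
      gcongr
      linarith [hB x hx]
  · have hsub : |flatKernel h x t - flatKernel h z t| ≤ dist x z / ρ ^ 2 := by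
      rcases hA x hx with hx | hx <;> rcases hA z hz with hz | hz
      · rw [flatKernel_of_eq hx, flatKernel_of_eq hz, sub_zero, abs_zero]; positivity
      · rw [flatKernel_of_eq hx, zero_sub, abs_neg]; exact hline x z hx hz
      · rw [flatKernel_of_eq hz, sub_zero, dist_comm]; exact hline z x hz hx
      · exact abs_flatKernel_sub_le hρ hx hz
    calc |flatKernel h x t - flatKernel h z t| ≤ dist x z / ρ ^ 2 := hsub
      _ = 1 / ρ ^ 2 * dist x z := by ring
      _ ≤ (B + 1) / ρ ^ 2 * dist x z := by gcongr; linarith [hB0 x hx]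

section Profile

variable {h w K L : ℝ} {f : ℝ → ℂ}

theorem integrable_flatKernel_mul (hf : Continuous f) (hsupp : ∀ t, w ≤ |t| → f t = 0)
    (x : Plane) : Integrable fun t => (flatKernel h x t : ℂ) * f t := by
  refine Continuous.integrable_of_hasCompactSupport
    ((Complex.continuous_ofReal.comp (continuous_flatKernel h x)).mul hf) ?_
  refine HasCompactSupport.intro (isCompact_Icc (a := -w) (b := w)) fun t ht => ?_
  rw [hsupp t (le_of_not_ge fun hle => ht (abs_le.1 hle)), mul_zero]

theorem norm_integral_le_of_support (hw : 0 ≤ w) {F : ℝ → ℂ} (hsupp : ∀ t, w ≤ |t| → F t = 0)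
    (hK : ∀ t, |t| < w → ‖F t‖ ≤ K) : ‖∫ t, F t‖ ≤ 2 * w * K := by
  rw [← setIntegral_eq_integral_of_forall_compl_eq_zero (s := Set.Ioo (-w) w) fun t ht =>
    hsupp t (le_of_not_gt fun hlt => ht (abs_lt.1 hlt))]
  refine (norm_setIntegral_le_of_norm_le_const (s := Set.Ioo (-w) w) measure_Ioo_lt_top
    fun t ht => hK t (abs_lt.2 ht)).trans_eq ?_
  rw [Real.volume_real_Ioo_of_le (by linarith)]
  ring

theorem boundedLipschitzOnWith_potential {B : ℝ} {A : Set Plane} (hw : 0 ≤ w) (hf : Continuous f)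
    (hK : ∀ t, ‖f t‖ ≤ K) (hsupp : ∀ t, w ≤ |t| → f t = 0)
    (hB : ∀ t, |t| < w → BoundedLipschitzOnWith B (fun x => flatKernel h x t) A) :
    BoundedLipschitzOnWith (2 * w * (B * K)) (potential h f) A where
  norm_le x hx := by
    refine norm_integral_le_of_support hw (fun t ht => by rw [hsupp t ht, mul_zero]) fun t ht => ?_
    refine norm_mul_le_of_le ?_ (hK t)
    rw [Complex.norm_real]
    exact (hB t ht).norm_le x hx
  norm_sub_le x hx z hz := by
    rw [potential, potential, ← integral_sub (integrable_flatKernel_mul hf hsupp x)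
      (integrable_flatKernel_mul hf hsupp z), mul_assoc, mul_right_comm B]
    simp_rw [← sub_mul, ← Complex.ofReal_sub]
    refine norm_integral_le_of_support hw (fun t ht => by rw [hsupp t ht, mul_zero]) fun t ht => ?_
    refine norm_mul_le_of_le ?_ (hK t)
    rw [Complex.norm_real]
    exact (hB t ht).norm_sub_le x hx z hz

theorem boundedLipschitzOnWith_layer {d : ℝ} {A : Set Plane} (hd : 0 < d)
    (hf : BoundedLipschitzOnWith L f Set.univ) (hsupp : ∀ t, w ≤ |t| → f t = 0)
    (hfar : ∀ x ∈ A, x 1 ≠ h → ∀ t, |t| < w → d ≤ dist x (horizontal h t)) :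
    BoundedLipschitzOnWith (L + L / d) (layer h f) A := by
  have hL : 0 ≤ L := (norm_nonneg _).trans (hf.norm_le 0 trivial)
  have hLd : 0 ≤ L / d := by positivity
  have hcross : ∀ x z : Plane, x 1 = h → z ∈ A → z 1 ≠ h → ‖f (x 0)‖ ≤ L / d * dist x z := by
    intro x z hx hz hzh
    rcases lt_or_ge |x 0| w with hxw | hxw
    · have hdist := hfar z hz hzh _ hxw
      rw [← hx, ← eq_horizontal, dist_comm] at hdist
      calc ‖f (x 0)‖ ≤ L := hf.norm_le _ trivial
        _ = L / d * d := by field_simp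
        _ ≤ L / d * dist x z := by gcongr
    · rw [hsupp _ hxw, norm_zero]; positivity
  refine ⟨fun x _ => ?_, fun x hx z hz => ?_⟩
  · by_cases hxh : x 1 = h
    · rw [layer_of_eq hxh]; linarith [hf.norm_le (x 0) trivial]
    · rw [layer_of_ne hxh, norm_zero]; positivity
  · have hxz : 0 ≤ L * dist x z := by positivity
    have hxzd : 0 ≤ L / d * dist x z := by positivity
    rw [add_mul]
    by_cases hxh : x 1 = h <;> by_cases hzh : z 1 = h
    · rw [layer_of_eq hxh, layer_of_eq hzh]
      have hcoord : L * dist (x 0) (z 0) ≤ L * dist x z := by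
        gcongr; exact abs_coord_sub_le_dist x z 0
      linarith [hf.norm_sub_le (x 0) trivial (z 0) trivial]
    · rw [layer_of_eq hxh, layer_of_ne hzh, sub_zero]
      linarith [hcross x z hxh hz hzh]
    · rw [layer_of_ne hxh, layer_of_eq hzh, zero_sub, norm_neg]
      linarith [dist_comm x z ▸ hcross z x hzh hx hxh]
    · rw [layer_of_ne hxh, layer_of_ne hzh, sub_zero, norm_zero]; positivity

theorem npKernel_horizontal {Ω : Set Plane} {h c t : ℝ}
    (hn : outwardNormal Ω (horizontal h t) = horizontal c 0) (x : Plane) :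
    npKernel Ω x (horizontal h t) = c / (2 * Real.pi) * flatKernel h x t := by
  simp only [npKernel, hn, flatKernel_eq_div_dist, dist_eq_norm, inner_eq, horizontal_zero,
    horizontal_one, PiLp.sub_apply]
  ring

theorem hasNPIntegral_layer {Ω : Set Plane} {c : ℝ} (hf : Continuous f)
    (hsupp : ∀ t, w ≤ |t| → f t = 0) (hfr : ∀ t, |t| < w → horizontal h t ∈ frontier Ω)
    (hn : ∀ t, |t| < w → outwardNormal Ω (horizontal h t) = horizontal c 0) (x : Plane) :
    HasNPIntegral Ω (layer h f) x ((c / (2 * Real.pi) : ℝ) * potential h f x) := by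
  set F : Plane → ℂ := fun y => (npKernel Ω x y : ℂ) * layer h f y with hF
  set G : ℝ → ℂ := fun t => (c / (2 * Real.pi) : ℝ) * ((flatKernel h x t : ℂ) * f t) with hG
  set I := Set.Ioo (-w) w
  have hI : ∀ t, t ∉ I → f t = 0 := fun t ht =>
    hsupp t (le_of_not_gt fun hlt => ht (abs_lt.1 hlt))
  have hF0 : ∀ y, y ∉ horizontal h '' I → F y = 0 := fun y hy => by
    by_cases hyh : y 1 = h
    · have hy0 : y 0 ∉ I := fun hmem => hy ⟨y 0, hmem, by rw [← hyh, ← eq_horizontal]⟩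
      simp only [hF, layer_of_eq hyh, hI _ hy0, mul_zero]
    · simp only [hF, layer_of_ne hyh, mul_zero]
  have hG0 : ∀ t, t ∉ I → G t = 0 := fun t ht => by simp only [hG, hI t ht, mul_zero]
  have hrestr : (arcLength Ω).restrict (horizontal h '' I) =
      Measure.map (horizontal h) (volume.restrict I) := by
    rw [arcLength, Measure.restrict_restrict_of_subset, restrict_horizontal_image]
    exact Set.image_subset_iff.2 fun t ht => hfr t (abs_lt.2 ht)
  have hFG : Set.EqOn (F ∘ horizontal h) G I := fun t ht => by
    simp only [Function.comp, hF, hG, layer_of_eq (horizontal_one h t), horizontal_zero,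
      npKernel_horizontal (hn t (abs_lt.2 ht)) x]
    push_cast
    ring
  have hGint : Integrable G := (integrable_flatKernel_mul hf hsupp x).const_mul _
  constructor
  · rw [← integrableOn_iff_integrable_of_support_subset
      (Function.support_subset_iff'.2 hF0), IntegrableOn, hrestr,
      (measurableEmbedding_horizontal h).integrable_map_iff]
    exact (integrableOn_congr_fun hFG measurableSet_Ioo).2 hGint.integrableOn
  · calc ∫ y, F y ∂(arcLength Ω) = ∫ t in I, F (horizontal h t) := by
          rw [← setIntegral_eq_integral_of_forall_compl_eq_zero hF0, hrestr,
            (measurableEmbedding_horizontal h).integral_map]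
      _ = ∫ t in I, G t := setIntegral_congr_fun measurableSet_Ioo hFG
      _ = (c / (2 * Real.pi) : ℝ) * potential h f x := by
          rw [setIntegral_eq_integral_of_forall_compl_eq_zero hG0, integral_const_mul, potential]

theorem IsFlatPiece.hasRegularPotential_layer {Ω : Set Plane} {c d : ℝ}
    (hF : IsFlatPiece Ω h w d) (hΩ : IsBoundedLipschitzDomain Ω) (hw : 0 ≤ w)
    (hn : ∀ t, |t| < w → outwardNormal Ω (horizontal h t) = horizontal c 0)
    (hf : BoundedLipschitzOnWith L f Set.univ) (hsupp : ∀ t, w ≤ |t| → f t = 0) :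
    HasRegularPotential Ω (layer h f) fun x => (c / (2 * Real.pi) : ℝ) * potential h f x where
  density := ⟨_, boundedLipschitzOnWith_layer hF.pos hf hsupp hF.far⟩
  hasNPIntegral := hasNPIntegral_layer hf.continuous hsupp hF.segment hn
  potential := by
    obtain ⟨B, hB⟩ := hΩ.isCompact_frontier.exists_bound_of_continuousOn
      (f := fun x : Plane => h - x 1) (by fun_prop)
    have hker : ∀ t, |t| < w → BoundedLipschitzOnWith ((B + 1) / d ^ 2)
        (fun x => flatKernel h x t) (frontier Ω) := fun t ht =>
      boundedLipschitzOnWith_flatKernel hF.pos hB fun x hx =>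
        or_iff_not_imp_left.2 fun hxh => hF.far x hx hxh t ht
    exact ⟨_, (boundedLipschitzOnWith_potential hw hf.continuous
      (fun t => hf.norm_le t trivial) hsupp hker).const_mul _⟩

end Profile

/-! ### The convolution kernel of the strip -/

/-- The kernel by which a density on one of two parallel lines at distance `2` acts on the other
one: the double layer kernel `(1 / 2π) * 2 / (4 + s²)`. -/
noncomputable def stripKernel (s : ℝ) : ℝ := 1 / (Real.pi * (4 + s ^ 2))

theorem stripKernel_nonneg (s : ℝ) : 0 ≤ stripKernel s := by
  unfold stripKernel; positivity

theorem stripKernel_eq (s : ℝ) :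
    stripKernel s = 1 / (4 * Real.pi) * (1 + (s / 2) ^ 2)⁻¹ := by
  unfold stripKernel; field_simp; ring

theorem continuous_stripKernel : Continuous stripKernel := by
  unfold stripKernel
  exact continuous_const.div (by fun_prop) fun s => by positivity

theorem integrable_stripKernel : Integrable stripKernel := by
  rw [funext stripKernel_eq]
  exact (integrable_inv_one_add_sq.comp_div two_ne_zero).const_mul _

theorem integral_stripKernel : ∫ s, stripKernel s = 1 / 2 := by
  rw [funext stripKernel_eq, integral_const_mul,
    Measure.integral_comp_div (fun s : ℝ => (1 + s ^ 2)⁻¹) 2, integral_univ_inv_one_add_sq,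
    abs_two, smul_eq_mul]
  field_simp
  norm_num

theorem integrable_stripKernel_mul {F : ℝ → ℂ} {C : ℝ} (hF : Continuous F)
    (hC : ∀ s, ‖F s‖ ≤ C) : Integrable fun s => (stripKernel s : ℂ) * F s :=
  integrable_stripKernel.ofReal.mul_bdd hF.aestronglyMeasurable (.of_forall hC)

theorem norm_integral_stripKernel_mul_le {F : ℝ → ℂ} {g : ℝ → ℝ}
    (hg : Integrable fun s => stripKernel s * g s) (hFg : ∀ s, ‖F s‖ ≤ g s) :
    ‖∫ s, (stripKernel s : ℂ) * F s‖ ≤ ∫ s, stripKernel s * g s := by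
  refine norm_integral_le_of_norm_le hg (.of_forall fun s => ?_)
  refine norm_mul_le_of_le ?_ (hFg s)
  rw [Complex.norm_real, Real.norm_of_nonneg (stripKernel_nonneg s)]

/-- The absolute moment of order `θ` of the strip kernel; it is finite for `θ < 1`. -/
noncomputable def stripMoment (θ : ℝ) : ℝ := ∫ s, stripKernel s * |s| ^ θ

theorem stripMoment_nonneg (θ : ℝ) : 0 ≤ stripMoment θ :=
  integral_nonneg fun s => mul_nonneg (stripKernel_nonneg s) (by positivity)

theorem integrable_stripKernel_mul_rpow {θ : ℝ} (h0 : 0 ≤ θ) (h1 : θ < 1) :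
    Integrable fun s => stripKernel s * |s| ^ θ := by
  have hint : Integrable fun s : ℝ => (1 + ‖s‖) ^ (-(2 - θ)) :=
    integrable_one_add_norm (by rw [Module.finrank_self, Nat.cast_one]; linarith)
  refine (hint.const_mul 2).mono' (continuous_stripKernel.mul
    (continuous_abs.rpow_const fun _ => .inr h0)).aestronglyMeasurable (.of_forall fun s => ?_)
  have hkernel : stripKernel s ≤ 2 * (1 + |s|) ^ (-2 : ℝ) := by
    rw [Real.rpow_neg (by positivity), Real.rpow_two, stripKernel, ← div_eq_mul_inv,
      div_le_div_iff₀ (by positivity) (by positivity), ← sq_abs s]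
    nlinarith [sq_nonneg (|s| - 1), Real.pi_gt_three]
  rw [Real.norm_of_nonneg (mul_nonneg (stripKernel_nonneg s) (by positivity)), Real.norm_eq_abs]
  calc stripKernel s * |s| ^ θ ≤ 2 * (1 + |s|) ^ (-2 : ℝ) * (1 + |s|) ^ θ := by
        gcongr
        linarith
    _ = 2 * (1 + |s|) ^ (-(2 - θ)) := by
        rw [mul_assoc, ← Real.rpow_add (by positivity)]; ring_nf

/-- The plane wave `e^{iξt}`. -/
noncomputable def wave (ξ t : ℝ) : ℂ := Complex.exp ((ξ * t : ℝ) * Complex.I)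

theorem norm_wave (ξ t : ℝ) : ‖wave ξ t‖ = 1 := Complex.norm_exp_ofReal_mul_I _

theorem wave_add (ξ s t : ℝ) : wave ξ (s + t) = wave ξ s * wave ξ t := by
  rw [wave, wave, wave, ← Complex.exp_add]
  push_cast
  ring_nf

theorem continuous_wave (ξ : ℝ) : Continuous (wave ξ) := by unfold wave; fun_prop

theorem conj_wave (ξ t : ℝ) : (starRingEnd ℂ) (wave ξ t) = wave ξ (-t) := by
  rw [wave, wave, ← Complex.exp_conj, map_mul, Complex.conj_ofReal, Complex.conj_I]
  push_cast
  ring_nf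

theorem norm_wave_sub_le (ξ s t : ℝ) : ‖wave ξ s - wave ξ t‖ ≤ |ξ| * |s - t| := by
  have hfactor : wave ξ s - wave ξ t =
      wave ξ t * (Complex.exp (Complex.I * (ξ * (s - t) : ℝ)) - 1) := by
    rw [mul_comm Complex.I, ← wave, mul_sub, ← wave_add, add_sub_cancel, mul_one]
  rw [hfactor, norm_mul, norm_wave, one_mul, ← abs_mul]
  exact Real.norm_exp_I_mul_ofReal_sub_one_le

theorem boundedLipschitzOnWith_wave (ξ : ℝ) :
    BoundedLipschitzOnWith (1 + |ξ|) (wave ξ) Set.univ where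
  norm_le t _ := by rw [norm_wave]; linarith [abs_nonneg ξ]
  norm_sub_le s _ t _ := (norm_wave_sub_le ξ s t).trans (by
    rw [Real.dist_eq]; gcongr; linarith)

/-- The Fourier symbol of convolution with the strip kernel. -/
noncomputable def stripSymbol (ξ : ℝ) : ℂ := ∫ s, (stripKernel s : ℂ) * wave ξ s

theorem stripSymbol_zero : stripSymbol 0 = (1 / 2 : ℝ) := by
  simp_rw [stripSymbol, wave, zero_mul, Complex.ofReal_zero, zero_mul, Complex.exp_zero, mul_one]
  rw [integral_complex_ofReal, integral_stripKernel]

theorem conj_stripSymbol (ξ : ℝ) : (starRingEnd ℂ) (stripSymbol ξ) = stripSymbol ξ := by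
  rw [stripSymbol, ← integral_conj, ← integral_neg_eq_self]
  simp_rw [map_mul, Complex.conj_ofReal, conj_wave, neg_neg, stripKernel, neg_sq]

theorem continuous_stripSymbol : Continuous stripSymbol := by
  refine continuous_of_dominated (bound := stripKernel)
    (fun ξ => (integrable_stripKernel_mul (continuous_wave ξ)
      fun s => (norm_wave ξ s).le).aestronglyMeasurable)
    (fun ξ => .of_forall fun s => ?_) integrable_stripKernel
    (.of_forall fun s => by unfold wave; fun_prop)
  rw [norm_mul, norm_wave, mul_one, Complex.norm_real, Real.norm_of_nonneg (stripKernel_nonneg s)]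

theorem tendsto_stripSymbol : Tendsto stripSymbol atTop (𝓝 0) := by
  have hscale : Tendsto (fun ξ : ℝ => -(ξ / (2 * Real.pi))) atTop (cocompact ℝ) :=
    (tendsto_neg_atTop_atBot.comp (tendsto_id.atTop_div_const (by positivity))).mono_right
      atBot_le_cocompact
  refine ((Real.tendsto_integral_exp_smul_cocompact fun s => (stripKernel s : ℂ)).comp
    hscale).congr fun ξ => integral_congr_ae (.of_forall fun s => ?_)
  change Real.fourierChar (-(s * -(ξ / (2 * Real.pi)))) • (stripKernel s : ℂ) = _
  have hphase : 2 * Real.pi * -(s * -(ξ / (2 * Real.pi))) = ξ * s := by field_simp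
  rw [Circle.smul_def, Real.fourierChar_apply, hphase, smul_eq_mul, mul_comm]
  rfl

theorem exists_stripSymbol_eq {lam : ℝ} (hlam : lam ∈ Set.Ioc (0 : ℝ) (1 / 2)) :
    ∃ ξ, stripSymbol ξ = lam := by
  have hlim : Tendsto (fun ξ => (stripSymbol ξ).re) atTop (𝓝 0) :=
    (Complex.continuous_re.tendsto 0).comp tendsto_stripSymbol
  obtain ⟨η, hη⟩ := (hlim.eventually_lt_const hlam.1).exists
  have hzero : lam ≤ (stripSymbol 0).re := by
    rw [stripSymbol_zero, Complex.ofReal_re]; exact hlam.2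
  obtain ⟨ξ, hξ⟩ := mem_range_of_exists_le_of_exists_ge
    (Complex.continuous_re.comp continuous_stripSymbol) ⟨η, hη.le⟩ ⟨0, hzero⟩
  exact ⟨ξ, by rw [← Complex.conj_eq_iff_re.1 (conj_stripSymbol ξ), ← hξ, Function.comp]⟩

/-! ### Wave packets -/

/-- The tent function of half-width `w`. -/
noncomputable def tent (w t : ℝ) : ℝ := max 0 (1 - |t| / w)

/-- The plane wave `e^{iξt}` cut off by the tent function of half-width `w`. -/
noncomputable def packet (ξ w t : ℝ) : ℂ := wave ξ t * tent w t

/-- The error of a packet as an eigenfunction of the convolution with the strip kernel, up to the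
phase `e^{iξx}`. -/
noncomputable def envelope (ξ w x : ℝ) : ℂ :=
  ∫ s, (stripKernel s : ℂ) * (wave ξ s * ((tent w x - tent w (x + s) : ℝ) : ℂ))

section Packet

variable {ξ w : ℝ}

theorem tent_nonneg (w t : ℝ) : 0 ≤ tent w t := le_max_left _ _

theorem continuous_tent (w : ℝ) : Continuous (tent w) := by unfold tent; fun_prop

theorem continuous_packet (ξ w : ℝ) : Continuous (packet ξ w) :=
  (continuous_wave ξ).mul (Complex.continuous_ofReal.comp (continuous_tent w))

theorem norm_packet (ξ w t : ℝ) : ‖packet ξ w t‖ = tent w t := by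
  rw [packet, norm_mul, norm_wave, one_mul, Complex.norm_real,
    Real.norm_of_nonneg (tent_nonneg w t)]

theorem tent_le_one (hw : 0 < w) (t : ℝ) : tent w t ≤ 1 :=
  max_le zero_le_one (sub_le_self 1 (by positivity))

theorem half_le_tent {t : ℝ} (hw : 0 < w) (ht : |t| ≤ w / 2) : 1 / 2 ≤ tent w t := by
  have hdiv : |t| / w ≤ 1 / 2 := by rw [div_le_iff₀ hw]; linarith
  exact le_max_of_le_right (by linarith)

theorem packet_eq_zero {t : ℝ} (hw : 0 < w) (ht : w ≤ |t|) : packet ξ w t = 0 := by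
  have htent : tent w t = 0 := max_eq_left (by rwa [sub_nonpos, one_le_div hw])
  rw [packet, htent, Complex.ofReal_zero, mul_zero]

theorem norm_packet_le_one (hw : 0 < w) (t : ℝ) : ‖packet ξ w t‖ ≤ 1 :=
  (norm_packet ξ w t).trans_le (tent_le_one hw t)

theorem abs_tent_sub_le (hw : 0 < w) (s t : ℝ) : |tent w s - tent w t| ≤ |s - t| / w := by
  refine (abs_max_sub_max_le_max 0 _ 0 _).trans ?_
  rw [sub_self, abs_zero, max_eq_right (abs_nonneg _), sub_sub_sub_cancel_left, ← sub_div, abs_div,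
    abs_of_pos hw, abs_sub_comm s]
  exact div_le_div_of_nonneg_right (abs_abs_sub_abs_le_abs_sub t s) hw.le

theorem abs_tent_sub_le_one (hw : 0 < w) (s t : ℝ) : |tent w s - tent w t| ≤ 1 :=
  abs_sub_le_of_nonneg_of_le (tent_nonneg w s) (tent_le_one hw s) (tent_nonneg w t)
    (tent_le_one hw t)

theorem abs_tent_sub_le_rpow {θ : ℝ} (hw : 0 < w) (h0 : 0 ≤ θ) (h1 : θ ≤ 1) (s t : ℝ) :
    |tent w s - tent w t| ≤ w ^ (-θ) * |s - t| ^ θ := by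
  calc |tent w s - tent w t| = |tent w s - tent w t| ^ (1 : ℝ) := (Real.rpow_one _).symm
    _ ≤ |tent w s - tent w t| ^ θ :=
        Real.rpow_le_rpow_of_exponent_ge' (abs_nonneg _) (abs_tent_sub_le_one hw s t) h0 h1
    _ ≤ (|s - t| / w) ^ θ := by gcongr; exact abs_tent_sub_le hw s t
    _ = w ^ (-θ) * |s - t| ^ θ := by
        rw [Real.div_rpow (abs_nonneg _) hw.le, Real.rpow_neg hw.le, div_eq_inv_mul]

theorem boundedLipschitzOnWith_tent (hw : 0 < w) :
    BoundedLipschitzOnWith (1 + w⁻¹) (fun t => (tent w t : ℂ)) Set.univ where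
  norm_le t _ := by
    rw [Complex.norm_real, Real.norm_of_nonneg (tent_nonneg w t)]
    exact (tent_le_one hw t).trans (le_add_of_nonneg_right (by positivity))
  norm_sub_le s _ t _ := by
    rw [← Complex.ofReal_sub, Complex.norm_real, Real.norm_eq_abs, Real.dist_eq]
    refine (abs_tent_sub_le hw s t).trans ?_
    rw [div_eq_inv_mul]
    gcongr
    exact le_add_of_nonneg_left zero_le_one

theorem boundedLipschitzOnWith_packet (ξ : ℝ) (hw : 0 < w) :
    BoundedLipschitzOnWith (2 * (1 + |ξ|) * (1 + w⁻¹)) (packet ξ w) Set.univ :=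
  (boundedLipschitzOnWith_wave ξ).mul (boundedLipschitzOnWith_tent hw)

theorem norm_envelope_le {θ : ℝ} (hw : 0 < w) (h0 : 0 ≤ θ) (h1 : θ < 1) (x : ℝ) :
    ‖envelope ξ w x‖ ≤ w ^ (-θ) * stripMoment θ := by
  have hint : Integrable fun s => stripKernel s * (w ^ (-θ) * |s| ^ θ) := by
    simp_rw [mul_left_comm (stripKernel _)]
    exact (integrable_stripKernel_mul_rpow h0 h1).const_mul _
  calc ‖envelope ξ w x‖ ≤ ∫ s, stripKernel s * (w ^ (-θ) * |s| ^ θ) := by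
        refine norm_integral_stripKernel_mul_le hint fun s => ?_
        rw [norm_mul, norm_wave, one_mul, Complex.norm_real, Real.norm_eq_abs]
        simpa only [sub_add_cancel_left, abs_neg] using abs_tent_sub_le_rpow hw h0 h1.le x (x + s)
    _ = w ^ (-θ) * stripMoment θ := by
        simp_rw [mul_left_comm (stripKernel _)]
        rw [integral_const_mul, stripMoment]

theorem integrable_envelope (hw : 0 < w) (x : ℝ) : Integrable fun s =>
    (stripKernel s : ℂ) * (wave ξ s * ((tent w x - tent w (x + s) : ℝ) : ℂ)) := by
  have htent := continuous_tent w
  have hwave := continuous_wave ξ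
  refine integrable_stripKernel_mul (C := 1) (by fun_prop) fun s => ?_
  rw [norm_mul, norm_wave, one_mul, Complex.norm_real]
  exact abs_tent_sub_le_one hw _ _

theorem norm_envelope_sub_le (hw : 0 < w) (x z : ℝ) :
    ‖envelope ξ w x - envelope ξ w z‖ ≤ |x - z| / w := by
  have hdiff : ∀ s, |tent w x - tent w (x + s) - (tent w z - tent w (z + s))| ≤
      2 * (|x - z| / w) := fun s => by
    have hshift := abs_tent_sub_le hw (x + s) (z + s)
    rw [add_sub_add_right_eq_sub] at hshift
    rw [sub_sub_sub_comm]
    linarith [abs_sub (tent w x - tent w z) (tent w (x + s) - tent w (z + s)),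
      abs_tent_sub_le hw x z]
  rw [envelope, envelope, ← integral_sub (integrable_envelope hw x) (integrable_envelope hw z)]
  simp_rw [← mul_sub, ← Complex.ofReal_sub]
  calc _ ≤ ∫ s, stripKernel s * (2 * (|x - z| / w)) := by
        refine norm_integral_stripKernel_mul_le (integrable_stripKernel.mul_const _) fun s => ?_
        rw [norm_mul, norm_wave, one_mul, Complex.norm_real, Real.norm_eq_abs]
        exact hdiff s
    _ = |x - z| / w := by rw [integral_mul_const, integral_stripKernel]; ring

theorem boundedLipschitzOnWith_envelope {θ : ℝ} (hw : 1 ≤ w) (h0 : 0 ≤ θ) (h1 : θ < 1) :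
    BoundedLipschitzOnWith (w ^ (-θ) * (stripMoment θ + 1)) (envelope ξ w) Set.univ := by
  have hw0 : 0 < w := by linarith
  have hpow : 0 ≤ w ^ (-θ) := by positivity
  rw [mul_add, mul_one]
  refine ⟨fun x _ => ?_, fun x _ z _ => ?_⟩
  · linarith [norm_envelope_le (ξ := ξ) hw0 h0 h1 x]
  · have hinv : w⁻¹ ≤ w ^ (-θ) := by
      rw [← Real.rpow_neg_one]
      exact Real.rpow_le_rpow_of_exponent_le hw (by linarith)
    calc ‖envelope ξ w x - envelope ξ w z‖ ≤ |x - z| / w := norm_envelope_sub_le hw0 x z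
      _ = w⁻¹ * dist x z := by rw [Real.dist_eq, div_eq_inv_mul]
      _ ≤ (w ^ (-θ) * stripMoment θ + w ^ (-θ)) * dist x z := by
        gcongr
        linarith [mul_nonneg hpow (stripMoment_nonneg θ)]

theorem packet_residual_eq (hw : 0 < w) (x : ℝ) :
    stripSymbol ξ * packet ξ w x - ∫ t, (stripKernel (t - x) : ℂ) * packet ξ w t =
      wave ξ x * envelope ξ w x := by
  have hshift : ∫ t, (stripKernel (t - x) : ℂ) * packet ξ w t =
      ∫ s, (stripKernel s : ℂ) * packet ξ w (x + s) := by
    rw [← integral_add_left_eq_self _ x]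
    simp_rw [add_sub_cancel_left]
  have hconv : Integrable fun s => (stripKernel s : ℂ) * packet ξ w (x + s) :=
    integrable_stripKernel_mul ((continuous_packet ξ w).comp (by fun_prop))
      fun s => norm_packet_le_one hw _
  have hsymbol : Integrable fun s => (stripKernel s : ℂ) * wave ξ s * packet ξ w x :=
    (integrable_stripKernel_mul (continuous_wave ξ) fun s => (norm_wave ξ s).le).mul_const _
  rw [hshift, stripSymbol, ← integral_mul_const, ← integral_sub hsymbol hconv, envelope,
    ← integral_const_mul]
  refine integral_congr_ae (.of_forall fun s => ?_)
  simp only [packet, wave_add]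
  push_cast
  ring

theorem boundedLipschitzOnWith_packet_residual {θ : ℝ} (hw : 1 ≤ w) (h0 : 0 ≤ θ) (h1 : θ < 1) :
    BoundedLipschitzOnWith (2 * (1 + |ξ|) * (w ^ (-θ) * (stripMoment θ + 1)))
      (fun x => stripSymbol ξ * packet ξ w x - ∫ t, (stripKernel (t - x) : ℂ) * packet ξ w t)
      Set.univ := by
  simp_rw [packet_residual_eq (show 0 < w by linarith)]
  exact (boundedLipschitzOnWith_wave ξ).mul (boundedLipschitzOnWith_envelope hw h0 h1)

end Packet

/-! ### Geometry of thin domains -/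

section ThinDomain

variable {Γl Γr Ω : Set Plane} {R w h : ℝ}

theorem mem_longSides_iff {x : Plane} :
    x ∈ longSides R ↔ |x 0| ≤ R ∧ (x 1 = 1 ∨ x 1 = -1) :=
  and_or_left.symm

theorem hausdorffMeasure_longSides_le (R : ℝ) :
    Measure.hausdorffMeasure 1 (longSides R) ≤ 2 * ENNReal.ofReal (2 * R) := by
  have hside : ∀ h : ℝ, Measure.hausdorffMeasure 1 {x : Plane | |x 0| ≤ R ∧ x 1 = h} ≤
      ENNReal.ofReal (2 * R) := fun h => by
    have hsub : {x : Plane | |x 0| ≤ R ∧ x 1 = h} ⊆ horizontal h '' Set.Icc (-R) R :=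
      fun x hx => ⟨x 0, abs_le.1 hx.1, by rw [← hx.2, ← eq_horizontal]⟩
    refine (measure_mono hsub).trans_eq ?_
    rw [hausdorffMeasure_horizontal_image, Real.volume_Icc, sub_neg_eq_add, two_mul]
  rw [two_mul]
  exact (measure_union_le _ _).trans (add_le_add (hside 1) (hside (-1)))

theorem isBounded_of_isBounded_shortSides (hb : Bornology.IsBounded (shortSides Γl Γr R)) :
    Bornology.IsBounded (Γl ∪ Γr) := by
  have htranslate : ∀ (a : Plane) (Γ : Set Plane), (fun x => x + a) '' Γ ⊆ shortSides Γl Γr R →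
      Bornology.IsBounded Γ := fun a Γ hΓ =>
    ((isometry_add_right a).antilipschitz.isBounded_preimage (hb.subset hΓ)).subset
      (Set.subset_preimage_image _ _)
  exact (htranslate _ Γl Set.subset_union_left).union (htranslate _ Γr Set.subset_union_right)

theorem exists_shortSides_bound (hb : Bornology.IsBounded (Γl ∪ Γr)) :
    ∃ D : ℝ, 1 ≤ D ∧ ∀ R : ℝ, ∀ x ∈ shortSides Γl Γr R, R - D ≤ |x 0| ∧ |x 1| ≤ D := by
  obtain ⟨C, hC⟩ := hb.exists_norm_le
  have hcoord : ∀ p ∈ Γl ∪ Γr, ∀ i, |p i| ≤ max C 1 := fun p hp i =>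
    ((PiLp.norm_apply_le p i).trans (hC p hp)).trans (le_max_left _ _)
  refine ⟨max C 1, le_max_right _ _, fun R x hx => ?_⟩
  rcases hx with ⟨p, hp, rfl⟩ | ⟨p, hp, rfl⟩
  · refine ⟨?_, by simpa using hcoord p (.inl hp) 1⟩
    simp only [PiLp.add_apply, Matrix.cons_val_zero]
    linarith [hcoord p (.inl hp) 0, neg_le_abs (p 0 + -R), le_abs_self (p 0)]
  · refine ⟨?_, by simpa using hcoord p (.inr hp) 1⟩
    simp only [PiLp.add_apply, Matrix.cons_val_zero]
    linarith [hcoord p (.inr hp) 0, le_abs_self (p 0 + R), neg_le_abs (p 0)]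

theorem hausdorffMeasure_shortSides_le (R R' : ℝ) :
    Measure.hausdorffMeasure 1 (shortSides Γl Γr R') ≤
      2 * Measure.hausdorffMeasure 1 (shortSides Γl Γr R) := by
  have htranslate : ∀ (a b : Plane) (Γ : Set Plane),
      (fun x => x + a) '' Γ ⊆ shortSides Γl Γr R →
      Measure.hausdorffMeasure 1 ((fun x => x + b) '' Γ) ≤
        Measure.hausdorffMeasure 1 (shortSides Γl Γr R) := fun a b Γ hΓ => by
    rw [(isometry_add_right b).hausdorffMeasure_image (.inl zero_le_one),
      ← (isometry_add_right a).hausdorffMeasure_image (.inl zero_le_one)]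
    exact measure_mono hΓ
  rw [two_mul]
  exact (measure_union_le _ _).trans (add_le_add
    (htranslate _ _ Γl Set.subset_union_left) (htranslate _ _ Γr Set.subset_union_right))

namespace IsThinDomain

theorem shortSides_subset (hΩ : IsThinDomain Γl Γr R Ω) : shortSides Γl Γr R ⊆ frontier Ω :=
  hΩ.frontier_eq ▸ Set.subset_union_right

theorem exists_shortSides_bound (hΩ : IsThinDomain Γl Γr R Ω) :
    ∃ D : ℝ, 1 ≤ D ∧ ∀ R' : ℝ, ∀ x ∈ shortSides Γl Γr R', R' - D ≤ |x 0| ∧ |x 1| ≤ D :=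
  ThinNP.exists_shortSides_bound <| isBounded_of_isBounded_shortSides <|
    hΩ.lipschitz.isCompact_frontier.isBounded.subset hΩ.shortSides_subset

theorem exists_hausdorffMeasure_frontier_le (hΩ : IsThinDomain Γl Γr R Ω) :
    ∃ S : ℝ, 0 ≤ S ∧ ∀ (R' : ℝ) (Ω' : Set Plane), 0 ≤ R' → IsThinDomain Γl Γr R' Ω' →
      Measure.hausdorffMeasure 1 (frontier Ω') ≤ ENNReal.ofReal (4 * R' + S) := by
  have hfin : Measure.hausdorffMeasure 1 (shortSides Γl Γr R) ≠ ∞ :=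
    ((measure_mono hΩ.shortSides_subset).trans_lt
      hΩ.lipschitz.hausdorffMeasure_frontier_lt_top).ne
  refine ⟨2 * (Measure.hausdorffMeasure 1 (shortSides Γl Γr R)).toReal, by positivity,
    fun R' Ω' hR' hΩ' => ?_⟩
  rw [hΩ'.frontier_eq, ENNReal.ofReal_add (by positivity) (by positivity),
    ENNReal.ofReal_mul zero_le_two, ENNReal.ofReal_toReal hfin, ENNReal.ofReal_ofNat]
  refine (measure_union_le _ _).trans (add_le_add ?_ (hausdorffMeasure_shortSides_le _ _))
  refine (hausdorffMeasure_longSides_le R').trans_eq ?_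
  rw [← ENNReal.ofReal_ofNat, ← ENNReal.ofReal_mul zero_le_two]
  ring_nf

theorem mem_frontier (hΩ : IsThinDomain Γl Γr R Ω) {x : Plane} (hx : x ∈ frontier Ω) :
    (x 1 = 1 ∨ x 1 = -1) ∨ x ∈ shortSides Γl Γr R := by
  rw [hΩ.frontier_eq] at hx
  exact hx.imp_left fun hlong => (mem_longSides_iff.1 hlong).2

theorem horizontal_mem_frontier (hΩ : IsThinDomain Γl Γr R Ω) (hh : h = 1 ∨ h = -1) {t : ℝ}
    (ht : |t| ≤ R) : horizontal h t ∈ frontier Ω := by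
  rw [hΩ.frontier_eq]
  exact .inl (mem_longSides_iff.2 ⟨by simpa using ht, by simpa using hh⟩)

theorem isFlatPiece (hΩ : IsThinDomain Γl Γr R Ω) (hh : h = 1 ∨ h = -1) (hwR : w ≤ R)
    (hshort : ∀ x ∈ shortSides Γl Γr R, w + 2 ≤ |x 0|) : IsFlatPiece Ω h w 2 := by
  refine ⟨two_pos, fun t ht => hΩ.horizontal_mem_frontier hh (ht.le.trans hwR),
    fun x hx hxh t ht => ?_⟩
  rcases hΩ.mem_frontier hx with hx1 | hxs
  · have hheight := abs_coord_sub_le_dist x (horizontal h t) 1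
    have hopposite : |x 1 - h| = 2 := by
      rcases hh with rfl | rfl
      · rw [hx1.resolve_left hxh]; norm_num
      · rw [hx1.resolve_right hxh]; norm_num
    rwa [horizontal_one, hopposite] at hheight
  · have habscissa := abs_coord_sub_le_dist x (horizontal h t) 0
    rw [horizontal_zero] at habscissa
    linarith [hshort x hxs, abs_sub_abs_le_abs_sub (x 0) t]

theorem disjoint_flatSide_frontier (hΩ : IsThinDomain Γl Γr R Ω) (hh : h = 1 ∨ h = -1)
    (hshort : ∀ x ∈ shortSides Γl Γr R, w ≤ |x 0|) (d : ℝ) :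
    Disjoint (flatSide h w d h) (frontier Ω) := by
  refine Set.disjoint_left.2 fun x ⟨hx0, hx1, _⟩ hx => ?_
  rcases hΩ.mem_frontier hx with hlong | hxs
  · rcases hlong with hlong | hlong <;> rcases hh with rfl | rfl <;> norm_num [hlong] at hx1
  · exact (hshort x hxs).not_gt hx0

/-- Otherwise `Ω` would contain the half-strip beyond the long side, which is unbounded. -/
theorem disjoint_flatSide (hΩ : IsThinDomain Γl Γr R Ω) (hh : h = 1 ∨ h = -1) (hw : 0 < w)
    (hshort : ∀ x ∈ shortSides Γl Γr R, w ≤ |x 0|) (d : ℝ) : Disjoint (flatSide h w d h) Ω := by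
  obtain ⟨C, hC⟩ := hΩ.lipschitz.isBounded.exists_norm_le
  rcases subset_or_disjoint_of_isPreconnected hΩ.lipschitz.isOpen (isPreconnected_flatSide hh)
    (hΩ.disjoint_flatSide_frontier hh hshort (max d (|C| + 2))) with hsub | hdis
  · have hmem : horizontal (h * (|C| + 2)) 0 ∈ Ω := by
      have hdepth : h * (h * (|C| + 2) - h) = |C| + 1 := by
        linear_combination (|C| + 1) * sq_eq_one_of_sign hh
      refine hsub ⟨by simpa using hw, ?_⟩
      rw [horizontal_one, hdepth]
      exact ⟨by positivity, lt_max_of_lt_right (by linarith)⟩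
    have hheight : |C| + 2 ≤ C := by
      calc |C| + 2 = |h * (|C| + 2)| := by
            rw [abs_mul, abs_of_pos (by positivity : 0 < |C| + 2)]
            rcases hh with rfl | rfl <;> simp
        _ ≤ C := by simpa using (PiLp.norm_apply_le _ 1).trans (hC _ hmem)
    linarith [le_abs_self C]
  · have hmono : flatSide h w d h ⊆ flatSide h w (max d (|C| + 2)) h :=
      fun x ⟨hx0, hx1, hxd⟩ => ⟨hx0, hx1, lt_max_of_lt_left hxd⟩
    exact hdis.mono_left hmono

theorem outwardNormal_horizontal (hΩ : IsThinDomain Γl Γr R Ω) (hh : h = 1 ∨ h = -1)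
    (hF : IsFlatPiece Ω h w 2) (hshort : ∀ x ∈ shortSides Γl Γr R, w ≤ |x 0|) {t : ℝ}
    (ht : |t| < w) : outwardNormal Ω (horizontal h t) = horizontal h 0 := by
  have hout := hΩ.disjoint_flatSide hh ((abs_nonneg t).trans_lt ht) hshort 2
  obtain ⟨τ, hτ, x, hxτ, hxΩ⟩ := exists_mem_flatSide hΩ.lipschitz.isOpen ht two_pos
    (frontier_subset_closure (hF.segment t ht))
  have hτh : τ = -h := by
    have hne : τ ≠ h := fun heq => hout.notMem_of_mem_left (heq ▸ hxτ) hxΩ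
    grind
  have hin : flatSide h w 2 τ ⊆ Ω :=
    (subset_or_disjoint_of_isPreconnected hΩ.lipschitz.isOpen (isPreconnected_flatSide hτ)
      (hF.disjoint_flatSide hτ)).resolve_right fun hdis => hdis.notMem_of_mem_left hxτ hxΩ
  exact outwardNormal_horizontal_eq hh ht two_pos hout (hτh ▸ hin)

end IsThinDomain

end ThinDomain

/-! ### The same profile on both long sides -/

section Twin

variable {w : ℝ} {f : ℝ → ℂ}

/-- The density with profile `f` on each of the two lines at height `1` and `-1`. -/
noncomputable def twinLayer (f : ℝ → ℂ) (x : Plane) : ℂ :=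
  layer 1 f x + layer (-1) f x

/-- The Neumann–Poincaré integral of `twinLayer f`, the normals on the two lines pointing away from
the strip between them. -/
noncomputable def twinPotential (f : ℝ → ℂ) (x : Plane) : ℂ :=
  (1 / (2 * Real.pi) : ℝ) * potential 1 f x + (-1 / (2 * Real.pi) : ℝ) * potential (-1) f x

theorem twinLayer_eq {x : Plane} (hx : x 1 = 1 ∨ x 1 = -1) : twinLayer f x = f (x 0) := by
  rcases hx with hx | hx
  · rw [twinLayer, layer_of_eq hx, layer_of_ne (by rw [hx]; norm_num), add_zero]
  · rw [twinLayer, layer_of_ne (by rw [hx]; norm_num), layer_of_eq hx, zero_add]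

theorem twinLayer_eq_zero (hsupp : ∀ t, w ≤ |t| → f t = 0) {x : Plane} (hx : w ≤ |x 0|) :
    twinLayer f x = 0 := by
  have hlayer : ∀ h, layer h f x = 0 := fun h => by
    by_cases hxh : x 1 = h
    · rw [layer_of_eq hxh, hsupp _ hx]
    · exact layer_of_ne hxh
  rw [twinLayer, hlayer, hlayer, add_zero]

theorem mul_potential_of_opposite {h : ℝ} (hh : h = 1 ∨ h = -1) (f : ℝ → ℂ) {x : Plane}
    (hx : x 1 = -h) : ((h / (2 * Real.pi) : ℝ) : ℂ) * potential h f x =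
      ∫ t, (stripKernel (t - x 0) : ℂ) * f t := by
  have hkernel : ∀ t, h / (2 * Real.pi) * flatKernel h x t = stripKernel (t - x 0) := fun t => by
    have hsq : h ^ 2 = 1 := by rw [sq, sq_eq_one_of_sign hh]
    rw [flatKernel, stripKernel, hx, sub_neg_eq_add, ← two_mul, mul_pow, hsq, div_mul_div_comm,
      mul_left_comm, ← sq, hsq, mul_one, mul_assoc, ← mul_div_mul_left 1 _ two_ne_zero, mul_one,
      add_comm (_ ^ 2)]
    norm_num
  simp_rw [potential, ← integral_const_mul, ← mul_assoc, ← Complex.ofReal_mul, hkernel]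

theorem twinPotential_eq (f : ℝ → ℂ) {x : Plane} (hx : x 1 = 1 ∨ x 1 = -1) :
    twinPotential f x = ∫ t, (stripKernel (t - x 0) : ℂ) * f t := by
  rcases hx with hx | hx
  · rw [twinPotential, potential_of_eq hx, mul_zero, zero_add,
      mul_potential_of_opposite (.inr rfl) f (by simpa using hx)]
  · rw [twinPotential, potential_of_eq hx, mul_zero, add_zero,
      mul_potential_of_opposite (.inl rfl) f hx]

theorem IsThinDomain.hasRegularPotential_twinLayer {Γl Γr Ω : Set Plane} {R L : ℝ}
    (hΩ : IsThinDomain Γl Γr R Ω) (hw : 0 ≤ w) (hwR : w ≤ R)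
    (hshort : ∀ x ∈ shortSides Γl Γr R, w + 2 ≤ |x 0|)
    (hf : BoundedLipschitzOnWith L f Set.univ) (hsupp : ∀ t, w ≤ |t| → f t = 0) :
    HasRegularPotential Ω (twinLayer f) (twinPotential f) := by
  have hlayer : ∀ {h : ℝ}, h = 1 ∨ h = -1 → HasRegularPotential Ω (layer h f)
      fun x => (h / (2 * Real.pi) : ℝ) * potential h f x := fun hh => by
    have hF := hΩ.isFlatPiece hh hwR hshort
    exact hF.hasRegularPotential_layer hΩ.lipschitz hw
      (fun t ht => hΩ.outwardNormal_horizontal hh hF (fun x hx => by linarith [hshort x hx]) ht)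
      hf hsupp
  exact (hlayer (.inl rfl)).add (hlayer (.inr rfl))

theorem boundedLipschitzOnWith_twinPotential {D K : ℝ} (hw : 0 < w) (hD : 0 ≤ D)
    (hf : Continuous f) (hK : ∀ t, ‖f t‖ ≤ K) (hsupp : ∀ t, w ≤ |t| → f t = 0) :
    BoundedLipschitzOnWith (32 * (D + 2) * K * w⁻¹) (twinPotential f)
      {x | 5 / 4 * w ≤ |x 0| ∧ |x 1| ≤ D} := by
  have hK0 : 0 ≤ K := (norm_nonneg _).trans (hK 0)
  have hpot : ∀ h : ℝ, |h| = 1 → BoundedLipschitzOnWith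
      (2 * w * ((1 + D + 1) / (w / 4) ^ 2 * K)) (potential h f)
      {x | 5 / 4 * w ≤ |x 0| ∧ |x 1| ≤ D} := fun h hh =>
    boundedLipschitzOnWith_potential hw.le hf hK hsupp fun t ht =>
      boundedLipschitzOnWith_flatKernel (by positivity)
        (fun x hx => (abs_sub _ _).trans (by linarith [hx.2])) fun x hx => by
          have habscissa := abs_coord_sub_le_dist x (horizontal h t) 0
          rw [horizontal_zero] at habscissa
          exact .inr (by linarith [hx.1, abs_sub_abs_le_abs_sub (x 0) t])
  refine (((hpot 1 (by simp)).const_mul _).add ((hpot (-1) (by simp)).const_mul _)).mono ?_ le_rfl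
  have hpi : 1 / (2 * Real.pi) ≤ 1 / 2 := by
    gcongr; linarith [Real.pi_gt_three]
  rw [Complex.norm_real, Complex.norm_real, neg_div, norm_neg, Real.norm_of_nonneg (by positivity),
    ← two_mul]
  calc 2 * (1 / (2 * Real.pi) * (2 * w * ((1 + D + 1) / (w / 4) ^ 2 * K)))
      ≤ 2 * (1 / 2 * (2 * w * ((1 + D + 1) / (w / 4) ^ 2 * K))) := by gcongr
    _ = 32 * (D + 2) * K * w⁻¹ := by field_simp; ring

end Twin

/-! ### Quasimodes -/

section Quasimode

variable {Γl Γr Ω : Set Plane} {h w D S K θ ξ lam : ℝ}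

theorem le_hHalfNorm_of_eq_packet {φ : Plane → ℂ} (hw : 0 < w)
    (hseg : ∀ t, |t| < w → horizontal h t ∈ frontier Ω)
    (hφ : ∀ t, φ (horizontal h t) = packet ξ w t) :
    ENNReal.ofReal (1 / 2) * ENNReal.ofReal w ^ (1 / 2 : ℝ) ≤ hHalfNorm Ω φ := by
  have hle := le_hHalfNorm (φ := φ) (a := w / 2) (b := 1 / 2)
    (fun t ht => hseg t (ht.trans_lt (half_lt_self hw))) fun t ht => by
      rw [hφ, norm_packet]
      exact half_le_tent hw ht
  rwa [mul_div_cancel₀ w two_ne_zero] at hle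

theorem hHalfNorm_ne_zero_of_eq_packet {φ : Plane → ℂ} (hw : 0 < w)
    (hseg : ∀ t, |t| < w → horizontal h t ∈ frontier Ω)
    (hφ : ∀ t, φ (horizontal h t) = packet ξ w t) : hHalfNorm Ω φ ≠ 0 := by
  refine (lt_of_lt_of_le ?_ (le_hHalfNorm_of_eq_packet hw hseg hφ)).ne'
  have hpos : 0 < ENNReal.ofReal w ^ (1 / 2 : ℝ) :=
    ENNReal.rpow_pos (ENNReal.ofReal_pos.2 hw) ENNReal.ofReal_ne_top
  exact ENNReal.mul_pos (by simp) hpos.ne'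

theorem IsBoundedLipschitzDomain.exists_isAdmissible (hΩ : IsBoundedLipschitzDomain Ω)
    (hw : 0 < w) (hseg : ∀ t, |t| < w → horizontal h t ∈ frontier Ω) (lam : ℝ) :
    ∃ φ, IsAdmissible Ω lam φ := by
  obtain ⟨w', d, hw', hF⟩ := hΩ.exists_isFlatPiece hw hseg
  obtain ⟨σ, -, hn⟩ := hΩ.exists_outwardNormal_eq hw' hF
  have hreg := hF.hasRegularPotential_layer hΩ hw'.le hn (boundedLipschitzOnWith_packet 0 hw')
    fun t => packet_eq_zero hw'
  refine ⟨_, hreg.isAdmissible hΩ (hHalfNorm_ne_zero_of_eq_packet (ξ := 0) hw' hF.segment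
    fun t => ?_) lam⟩
  rw [layer_of_eq (horizontal_one h t), horizontal_zero]

/-- A bound for `w ^ θ` times the supremum and the Lipschitz constant of `λφ - Kφ`, where `φ` has
the profile `packet ξ w` on both long sides and the short sides reach up to the height `D`. -/
noncomputable def residualConst (θ ξ D : ℝ) : ℝ :=
  2 * (2 * (1 + |ξ|) * (stripMoment θ + 1) + 32 * (D + 2))

theorem residualConst_nonneg (hD : 0 ≤ D) : 0 ≤ residualConst θ ξ D := by
  have hM := stripMoment_nonneg θ
  unfold residualConst
  positivity

theorem boundedLipschitzOnWith_residual_long (hw : 1 ≤ w) (h0 : 0 ≤ θ) (h1 : θ < 1) :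
    BoundedLipschitzOnWith (2 * (1 + |ξ|) * (stripMoment θ + 1) * w ^ (-θ))
      (fun x => stripSymbol ξ * twinLayer (packet ξ w) x - twinPotential (packet ξ w) x)
      {x | x 1 = 1 ∨ x 1 = -1} := by
  have hM := stripMoment_nonneg θ
  have hpacket := (boundedLipschitzOnWith_packet_residual (ξ := ξ) hw h0 h1).comp_of_dist_le
    (S := {x : Plane | x 1 = 1 ∨ x 1 = -1}) (by positivity)
    (fun x z => abs_coord_sub_le_dist x z 0) (Set.mapsTo_univ _ _)
  refine (hpacket.mono (by linarith) le_rfl).congr fun x hx => ?_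
  rw [twinLayer_eq hx, twinPotential_eq _ hx, Function.comp_apply]

theorem boundedLipschitzOnWith_residual_ends (hw : 1 ≤ w) (hD : 0 ≤ D) (h1 : θ ≤ 1) :
    BoundedLipschitzOnWith (32 * (D + 2) * w ^ (-θ))
      (fun x => stripSymbol ξ * twinLayer (packet ξ w) x - twinPotential (packet ξ w) x)
      {x | 5 / 4 * w ≤ |x 0| ∧ |x 1| ≤ D} := by
  have hw0 : 0 < w := by linarith
  have hpot := (boundedLipschitzOnWith_twinPotential hw0 hD (continuous_packet ξ w)
    (norm_packet_le_one hw0) fun t => packet_eq_zero hw0).const_mul (-1)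
  have hinv : w⁻¹ ≤ w ^ (-θ) := by
    rw [← Real.rpow_neg_one]
    exact Real.rpow_le_rpow_of_exponent_le hw (neg_le_neg h1)
  refine (hpot.mono ?_ le_rfl).congr fun x hx => ?_
  · rw [norm_neg, norm_one, one_mul, mul_one]
    gcongr
  · simp only [twinLayer_eq_zero (fun t => packet_eq_zero hw0) (show w ≤ |x 0| by linarith [hx.1]),
      mul_zero, zero_sub, neg_one_mul]

theorem IsThinDomain.boundedLipschitzOnWith_frontier {r : Plane → ℂ} {L : ℝ}
    (hΩ : IsThinDomain Γl Γr (2 * w) Ω) (hD : 1 ≤ D)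
    (hshort : ∀ x ∈ shortSides Γl Γr (2 * w), 2 * w - D ≤ |x 0| ∧ |x 1| ≤ D)
    (hw : 2 * D + 4 ≤ w) (hlong : BoundedLipschitzOnWith L r {x | x 1 = 1 ∨ x 1 = -1})
    (hends : BoundedLipschitzOnWith L r {x | 5 / 4 * w ≤ |x 0| ∧ |x 1| ≤ D}) :
    BoundedLipschitzOnWith (2 * L) r (frontier Ω) := by
  set A : Set Plane := {x ∈ frontier Ω | x 1 = 1 ∨ x 1 = -1}
  set B : Set Plane := {x ∈ frontier Ω | 5 / 4 * w ≤ |x 0| ∧ |x 1| ≤ D}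
  have hheight : ∀ x ∈ frontier Ω, |x 1| ≤ D := fun x hx => by
    rcases hΩ.mem_frontier hx with hx1 | hxs
    · rwa [(abs_eq zero_le_one).2 hx1]
    · exact (hshort x hxs).2
  have hnear : ∀ x ∈ shortSides Γl Γr (2 * w), ∀ z ∈ frontier Ω, dist x z < 1 → z ∈ B :=
    fun x hx z hz hxz => by
      have habscissa := abs_coord_sub_le_dist x z 0
      exact ⟨hz, by linarith [(hshort x hx).1, abs_sub_abs_le_abs_sub (x 0) (z 0)], hheight z hz⟩
  have hself : ∀ x ∈ shortSides Γl Γr (2 * w), x ∈ B := fun x hx =>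
    hnear x hx x (hΩ.shortSides_subset hx) (by simp)
  have hcover : A ∪ B = frontier Ω :=
    (Set.union_subset (Set.sep_subset _ _) (Set.sep_subset _ _)).antisymm fun x hx =>
      (hΩ.mem_frontier hx).imp (fun hx1 => ⟨hx, hx1⟩) (hself x)
  have hunion := (hlong.mono le_rfl fun x (hx : x ∈ A) => hx.2).union
    (hends.mono le_rfl fun x (hx : x ∈ B) => hx.2)
  rw [hcover] at hunion
  refine hunion fun x hx z hz hxz => ?_
  rcases hΩ.mem_frontier hx with hx1 | hxs
  · rcases hΩ.mem_frontier hz with hz1 | hzs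
    · exact .inl ⟨⟨hx, hx1⟩, hz, hz1⟩
    · exact .inr ⟨hnear z hzs x hx (dist_comm x z ▸ hxz), hself z hzs⟩
  · exact .inr ⟨hself x hxs, hnear x hxs z hz hxz⟩

theorem IsThinDomain.boundedLipschitzOnWith_residual (hΩ : IsThinDomain Γl Γr (2 * w) Ω)
    (hD : 1 ≤ D) (hshort : ∀ x ∈ shortSides Γl Γr (2 * w), 2 * w - D ≤ |x 0| ∧ |x 1| ≤ D)
    (hw : 2 * D + 4 ≤ w) (h0 : 0 ≤ θ) (h1 : θ < 1) :
    BoundedLipschitzOnWith (residualConst θ ξ D * w ^ (-θ))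
      (fun x => stripSymbol ξ * twinLayer (packet ξ w) x - twinPotential (packet ξ w) x)
      (frontier Ω) := by
  have hw1 : 1 ≤ w := by linarith
  have hD0 : 0 ≤ D := by linarith
  have hM := stripMoment_nonneg θ
  have hlong := (boundedLipschitzOnWith_residual_long (ξ := ξ) hw1 h0 h1).mono
    (le_add_of_nonneg_right (by positivity : 0 ≤ 32 * (D + 2) * w ^ (-θ))) le_rfl
  have hends := (boundedLipschitzOnWith_residual_ends (ξ := ξ) hw1 hD0 h1.le).mono
    (le_add_of_nonneg_left
      (by positivity : 0 ≤ 2 * (1 + |ξ|) * (stripMoment θ + 1) * w ^ (-θ))) le_rfl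
  rw [residualConst, mul_assoc, add_mul]
  exact hΩ.boundedLipschitzOnWith_frontier hD hshort hw hlong hends

theorem hHalfNorm_div_le {φ r : Plane → ℂ} (hw : 1 ≤ w) (hK : 0 ≤ K) (hS : 0 ≤ S)
    (hr : BoundedLipschitzOnWith (K * w ^ (-θ)) r (frontier Ω))
    (hlen : Measure.hausdorffMeasure 1 (frontier Ω) ≤ ENNReal.ofReal (8 * w + S))
    (hφ : ENNReal.ofReal (1 / 2) * ENNReal.ofReal w ^ (1 / 2 : ℝ) ≤ hHalfNorm Ω φ) :
    hHalfNorm Ω r / hHalfNorm Ω φ ≤ ENNReal.ofReal (2 * K * (9 + S) * w ^ (1 / 2 - θ)) := by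
  have hw0 : 0 < w := by linarith
  have hpow : w ^ (-θ) * w = w ^ (1 / 2 - θ) * w ^ (1 / 2 : ℝ) := by
    nth_rewrite 2 [← Real.rpow_one w]
    rw [← Real.rpow_add hw0, ← Real.rpow_add hw0]
    ring_nf
  have hreal : K * w ^ (-θ) * (1 + (8 * w + S)) ≤
      2 * K * (9 + S) * w ^ (1 / 2 - θ) * (1 / 2 * w ^ (1 / 2 : ℝ)) := calc
    _ ≤ K * w ^ (-θ) * ((9 + S) * w) := by gcongr; nlinarith
    _ = K * (9 + S) * (w ^ (-θ) * w) := by ring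
    _ = _ := by rw [hpow]; ring
  refine ENNReal.div_le_of_le_mul ?_
  calc hHalfNorm Ω r ≤ ENNReal.ofReal (K * w ^ (-θ)) * (1 + ENNReal.ofReal (8 * w + S)) := by
        grw [hr.hHalfNorm_le, hlen]
    _ = ENNReal.ofReal (K * w ^ (-θ) * (1 + (8 * w + S))) := by
        rw [ENNReal.ofReal_mul (q := 1 + (8 * w + S)) (by positivity),
          ENNReal.ofReal_add zero_le_one (by positivity), ENNReal.ofReal_one]
    _ ≤ _ := ENNReal.ofReal_le_ofReal hreal
    _ = ENNReal.ofReal (2 * K * (9 + S) * w ^ (1 / 2 - θ)) *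
          (ENNReal.ofReal (1 / 2) * ENNReal.ofReal w ^ (1 / 2 : ℝ)) := by
        rw [ENNReal.ofReal_mul (by positivity), ENNReal.ofReal_mul one_half_pos.le,
          ENNReal.ofReal_rpow_of_nonneg hw0.le one_half_pos.le]
    _ ≤ _ := by gcongr

/-- The ratio of `‖λφ - Kφ‖` and `‖φ‖` in `H^{1/2}(∂Ω)`. -/
noncomputable def residualRatio (Ω : Set Plane) (lam : ℝ) (φ : Plane → ℂ) : ℝ≥0∞ :=
  hHalfNorm Ω (fun x => (lam : ℂ) * φ x - npOperator Ω φ x) / hHalfNorm Ω φ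

theorem IsThinDomain.exists_quasimode (hΩ : IsThinDomain Γl Γr (2 * w) Ω) (hD : 1 ≤ D)
    (hshort : ∀ x ∈ shortSides Γl Γr (2 * w), 2 * w - D ≤ |x 0| ∧ |x 1| ≤ D) (hS : 0 ≤ S)
    (hlen : Measure.hausdorffMeasure 1 (frontier Ω) ≤ ENNReal.ofReal (8 * w + S))
    (hw : 2 * D + 4 ≤ w) (h0 : 0 ≤ θ) (h1 : θ < 1) (hξ : stripSymbol ξ = lam) :
    ∃ φ, IsAdmissible Ω lam φ ∧ residualRatio Ω lam φ ≤
      ENNReal.ofReal (2 * residualConst θ ξ D * (9 + S) * w ^ (1 / 2 - θ)) := by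
  have hw0 : 0 < w := by linarith
  have hseg : ∀ t, |t| < w → horizontal 1 t ∈ frontier Ω := fun t ht =>
    hΩ.horizontal_mem_frontier (.inl rfl) (by linarith)
  have hprofile : ∀ t, twinLayer (packet ξ w) (horizontal 1 t) = packet ξ w t := fun t => by
    rw [twinLayer_eq (.inl (horizontal_one 1 t)), horizontal_zero]
  have hreg := hΩ.hasRegularPotential_twinLayer hw0.le (by linarith)
    (fun x hx => by linarith [(hshort x hx).1]) (boundedLipschitzOnWith_packet ξ hw0)
    fun t => packet_eq_zero hw0
  refine ⟨twinLayer (packet ξ w), hreg.isAdmissible hΩ.lipschitz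
    (hHalfNorm_ne_zero_of_eq_packet hw0 hseg hprofile) lam, ?_⟩
  rw [residualRatio, hreg.npOperator_eq, ← hξ]
  exact hHalfNorm_div_le (by linarith) (residualConst_nonneg (by linarith)) hS
    (hΩ.boundedLipschitzOnWith_residual hD hshort hw h0 h1) hlen
    (le_hHalfNorm_of_eq_packet hw0 hseg hprofile)

theorem IsThinDomain.exists_asymptotic_quasimode {R₁ : ℝ} {Ω₁ : Set Plane}
    (hΩ₁ : IsThinDomain Γl Γr R₁ Ω₁) (hlam : lam ∈ Set.Ioc (0 : ℝ) (1 / 2)) :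
    ∃ C R₂ : ℝ, ∀ R ≥ R₂, ∀ Ω, IsThinDomain Γl Γr R Ω → ∃ φ, IsAdmissible Ω lam φ ∧
      residualRatio Ω lam φ ≤ ENNReal.ofReal (C * (R / 2) ^ (-(1 / 4) : ℝ)) := by
  obtain ⟨ξ, hξ⟩ := exists_stripSymbol_eq hlam
  obtain ⟨D, hD, hshort⟩ := hΩ₁.exists_shortSides_bound
  obtain ⟨S, hS, hlen⟩ := hΩ₁.exists_hausdorffMeasure_frontier_le
  refine ⟨2 * residualConst (3 / 4) ξ D * (9 + S), 2 * (2 * D + 4), fun R hR Ω hΩ => ?_⟩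
  obtain ⟨w, rfl⟩ : ∃ w, R = 2 * w := ⟨R / 2, by ring⟩
  have hlen := hlen _ Ω (by linarith) hΩ
  rw [← mul_assoc] at hlen
  norm_num only at hlen
  obtain ⟨φ, hφ, hratio⟩ := hΩ.exists_quasimode hD (hshort _) hS hlen (by linarith)
    (θ := 3 / 4) (by norm_num) (by norm_num) hξ
  refine ⟨φ, hφ, hratio.trans_eq ?_⟩
  rw [mul_div_cancel_left₀ w two_ne_zero]
  norm_num only

end Quasimode

end ThinNP

theorem proposition3p1_general
    (Γl Γr : Set ThinNP.Plane) (R₀ : ℝ) (hR₀ : 0 < R₀)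
    (Ω : ℝ → Set ThinNP.Plane)
    (hΩ : ∀ R : ℝ, R₀ ≤ R → ThinNP.IsThinDomain Γl Γr R (Ω R))
    (lam : ℝ) (hlam : lam ∈ Set.Ioc (0 : ℝ) (1 / 2)) :
    ∃ φ : ℝ → ThinNP.Plane → ℂ,
      (∀ R : ℝ, R₀ ≤ R → ThinNP.IsAdmissible (Ω R) lam (φ R)) ∧
      Tendsto (fun R : ℝ => ThinNP.residualRatio (Ω R) lam (φ R)) atTop (𝓝 0) := by
  obtain ⟨C, R₂, hquasi⟩ := (hΩ R₀ le_rfl).exists_asymptotic_quasimode hlam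
  have hexists : ∀ R : ℝ, ∃ φ, R₀ ≤ R → ThinNP.IsAdmissible (Ω R) lam φ ∧
      (R₂ ≤ R → ThinNP.residualRatio (Ω R) lam φ ≤
        ENNReal.ofReal (C * (R / 2) ^ (-(1 / 4) : ℝ))) := fun R => by
    by_cases hR : R₀ ≤ R
    · by_cases hR₂ : R₂ ≤ R
      · exact (hquasi R hR₂ _ (hΩ R hR)).imp fun φ hφ _ => ⟨hφ.1, fun _ => hφ.2⟩
      · obtain ⟨φ, hφ⟩ := (hΩ R hR).lipschitz.exists_isAdmissible (hR₀.trans_le hR)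
          (fun t ht => (hΩ R hR).horizontal_mem_frontier (.inl rfl) ht.le) lam
        exact ⟨φ, fun _ => ⟨hφ, fun hR₂' => absurd hR₂' hR₂⟩⟩
    · exact ⟨0, fun hR' => absurd hR' hR⟩
  choose φ hφ using hexists
  refine ⟨φ, fun R hR => (hφ R hR).1, ?_⟩
  have hrate : Tendsto (fun R : ℝ => ENNReal.ofReal (C * (R / 2) ^ (-(1 / 4) : ℝ)))
      atTop (𝓝 0) := by
    have hpow : Tendsto (fun R : ℝ => (R / 2) ^ (-(1 / 4) : ℝ)) atTop (𝓝 0) :=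
      (tendsto_rpow_neg_atTop (by norm_num)).comp (tendsto_id.atTop_div_const two_pos)
    simpa using ENNReal.tendsto_ofReal (hpow.const_mul C)
  refine tendsto_of_tendsto_of_tendsto_of_le_of_le' tendsto_const_nhds hrate
    (.of_forall fun _ => zero_le) ?_
  filter_upwards [eventually_ge_atTop R₀, eventually_ge_atTop R₂] with R hR hR₂
  exact (hφ R hR).2 hR₂

theorem proposition3p1
    (Γl Γr : Set ThinNP.Plane)
    (hΓl : ThinNP.IsSimpleCurve Γl !₂[0, 1] !₂[0, -1])
    (hΓr : ThinNP.IsSimpleCurve Γr !₂[0, 1] !₂[0, -1])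
    (R₀ : ℝ) (hR₀ : 1 ≤ R₀)
    (Ω : ℝ → Set ThinNP.Plane)
    (hΩ : ∀ R : ℝ, R₀ ≤ R → ThinNP.IsThinDomain Γl Γr R (Ω R))
    (lam : ℝ) (hlam : lam ∈ Set.Ioc (0 : ℝ) (1 / 2)) :
    ∃ φ : ℝ → ThinNP.Plane → ℂ,
      (∀ R : ℝ, R₀ ≤ R →
        ThinNP.MemHHalf (Ω R) (φ R) ∧
        ThinNP.hHalfNorm (Ω R) (φ R) ≠ 0 ∧
        (∀ᵐ x ∂(ThinNP.arcLength (Ω R)), ThinNP.NPExists (Ω R) (φ R) x) ∧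
        ThinNP.MemHHalf (Ω R)
          (fun x => (lam : ℂ) * φ R x - ThinNP.npOperator (Ω R) (φ R) x)) ∧
      Tendsto
        (fun R : ℝ =>
          ThinNP.hHalfNorm (Ω R)
              (fun x => (lam : ℂ) * φ R x - ThinNP.npOperator (Ω R) (φ R) x) /
            ThinNP.hHalfNorm (Ω R) (φ R))
        atTop (𝓝 0) :=
  proposition3p1_general Γl Γr R₀ (zero_lt_one.trans_le hR₀) Ω hΩ lam hlam
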